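/- **Theorem.** Let $T>0$, let $f:\mathbb{R}^n\times\mathbb{R}^m\to\mathbb{R}^n$ be $C^2$, let $x_0\in\mathbb{R}^n$, and let $K:[0,T]\to\mathbb{R}^{m\times n}$ be measurable and (essentially) bounded. Let $E$ be the Banach space of curves $\xi=(\alpha,\mu)$ on $[0,T]$ with $\alpha:[0,T]\to\mathbb{R}^n$ continuous and $\mu\in L_\infty([0,T];\mathbb{R}^m)$, with the $L_\infty$ norm. Let $\mathcal{T}\subset E$ be the set of trajectories, i.e. of the curves $(x,u)\in E$ with $\dot x=f(x,u)$, $x(0)=x_0$, meaning $x(t)=x_0+\int_0^t f(x(s),u(s))\,ds$ for all $t\in[0,T]$. The trajectory tracking projection operator $\mathcal{P}:\xi=(\alpha,\mu)\mapsto\eta=(x,u)$ sends $\xi$ to the solution of the feedback system $$\dot x=f(x,u),\quad x(0)=x_0,\qquad u(t)=\mu(t)+K(t)\bigl(\alpha(t)-x(t)\bigr),$$ and $\operatorname{dom}\mathcal{P}\subset E$ is the set of $\xi$ for which this solution exists on all of $[0,T]$. For $\xi\in\mathcal{T}$ put $T_\xi\mathcal{T}=\{\zeta\in E: D\mathcal{P}(\xi)\cdot\zeta=\zeta\}$.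 Let $$h(\eta,\rho)=\int_0^T l\bigl(t,x(t),u(t),\rho\bigr)\,dt+\varphi\bigl(x(T),\rho\bigr),\qquad \eta=(x,u),\ \rho\in\mathbb{R}^p,$$ where $\varphi$ is $C^2$, and, for each $t\in[0,T]$, $l(t,\cdot)$ is $C^2$ in $(x,u,\rho)$, with $l$ and its derivatives in $(x,u,\rho)$ up to order $2$ continuous in $(t,x,u,\rho)\in[0,T]\times\mathbb{R}^n\times\mathbb{R}^m\times\mathbb{R}^p$. Put $g_\rho(\xi)=h(\mathcal{P}(\xi),\rho)$. A curve $\xi$ is called an *SSC local minimizer* of $g_\rho$ if $\xi\in\mathcal{T}$, $\xi$ is a local minimizer of $g_\rho$ (in the $L_\infty$ norm), and there is $c>0$ such that $$D^2g_\rho(\xi)\cdot(\zeta,\zeta)\ \ge\ c\,\|\zeta\|_{L_2}^2\qquad\text{for all }\zeta\in T_\xi\mathcal{T}.$$ Suppose that $\xi_0\in\mathcal{T}$ is an SSC local minimizer of $g_0$. Then there are $\delta>0$ and a map $\rho\mapsto\xi_\rho\in E$ which is continuously differentiable on the ball $\{\rho\in\mathbb{R}^p:\|\rho\|<\delta\}$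 and equals $\xi_0$ at $\rho=0$, such that for each $\rho$ with $\|\rho\|<\delta$ the curve $\xi_\rho$ is an SSC local minimizer of $g_\rho$ (and $\mathcal{P}$ is defined on a neighborhood of $\xi_\rho$, with $\mathcal{P}$ and $g_\rho$ of class $C^2$ near $\xi_\rho$). -/

import Mathlib

open MeasureTheory Set Topology

noncomputable section

namespace TrajOpt

/-- `ℝᵏ` with the Euclidean norm. -/
abbrev Vec (k : ℕ) := EuclideanSpace ℝ (Fin k)

/-- The state-input curves on `[0, T]` with continuous state and essentially bounded measurable
input, with the `L_∞` norm. -/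
abbrev Curve (n m : ℕ) (T : ℝ) :=
  C(Icc (0 : ℝ) T, Vec n) × Lp (Vec m) ⊤ (volume.restrict (Icc (0 : ℝ) T))

variable {n m p : ℕ} {T : ℝ}

/-- The state component of a curve as a function of time (only its values on `[0, T]` matter). -/
def Curve.state (hT : 0 < T) (η : Curve n m T) : ℝ → Vec n := IccExtend hT.le η.1

/-- The input component of a curve as a function of time. -/
def Curve.input (η : Curve n m T) : ℝ → Vec m := η.2

/-- The square of the `L_2` norm of a curve. -/
def Curve.sqL2 (hT : 0 < T) (ζ : Curve n m T) : ℝ :=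
  ∫ t in (0 : ℝ)..T, (‖Curve.state hT ζ t‖ ^ 2 + ‖Curve.input ζ t‖ ^ 2)

/-- The trajectories `η = (x, u)` on `[0, T]` of `x' = f (x, u)`, `x 0 = x₀`
(Carathéodory solutions). -/
def trajectories (hT : 0 < T) (f : Vec n × Vec m → Vec n) (x₀ : Vec n) : Set (Curve n m T) :=
  {η | ∀ t ∈ Icc (0 : ℝ) T,
    Curve.state hT η t = x₀ + ∫ s in (0 : ℝ)..t, f (Curve.state hT η s, Curve.input η s)}

/-- `η = (x, u)` is the response of the feedback system
`x' = f (x, u)`, `x 0 = x₀`, `u = μ + K (α - x)` to the curve `ξ = (α, μ)`. -/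
def IsFeedbackResponse (hT : 0 < T) (f : Vec n × Vec m → Vec n) (x₀ : Vec n)
    (K : ℝ → Vec n →L[ℝ] Vec m) (ξ η : Curve n m T) : Prop :=
  η ∈ trajectories hT f x₀ ∧
    ∀ᵐ t ∂(volume.restrict (Icc (0 : ℝ) T)),
      Curve.input η t = Curve.input ξ t + K t (Curve.state hT ξ t - Curve.state hT η t)

/-- The domain of the projection operator: the curves to which the feedback system has a response
on all of `[0, T]`. -/
def projectionDom (hT : 0 < T) (f : Vec n × Vec m → Vec n) (x₀ : Vec n)
    (K : ℝ → Vec n →L[ℝ] Vec m) : Set (Curve n m T) :=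
  {ξ | ∃ η, IsFeedbackResponse hT f x₀ K ξ η}

open Classical in
/-- The trajectory tracking projection operator `ξ = (α, μ) ↦ η = (x, u)`
(with the value `0` outside of its domain). -/
def projection (hT : 0 < T) (f : Vec n × Vec m → Vec n) (x₀ : Vec n)
    (K : ℝ → Vec n →L[ℝ] Vec m) (ξ : Curve n m T) : Curve n m T :=
  if h : ∃ η, IsFeedbackResponse hT f x₀ K ξ η then h.choose else 0

/-- The tangent space at `ξ` of the trajectory manifold: the fixed points of the derivative at `ξ`
of the projection operator. -/
def tangentSpace (hT : 0 < T) (f : Vec n × Vec m → Vec n) (x₀ : Vec n)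
    (K : ℝ → Vec n →L[ℝ] Vec m) (ξ : Curve n m T) : Set (Curve n m T) :=
  {ζ | fderiv ℝ (projection hT f x₀ K) ξ ζ = ζ}

/-- The cost `h(η, ρ) = ∫₀ᵀ l(t, x(t), u(t), ρ) dt + φ(x(T), ρ)` of a curve `η = (x, u)`. -/
def cost (hT : 0 < T) (l : ℝ → Vec n × Vec m × Vec p → ℝ) (φ : Vec n × Vec p → ℝ)
    (η : Curve n m T) (ρ : Vec p) : ℝ :=
  (∫ t in (0 : ℝ)..T, l t (Curve.state hT η t, Curve.input η t, ρ)) + φ (Curve.state hT η T, ρ)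

/-- The functional `g_ρ(ξ) = h(P(ξ), ρ)`. -/
def reducedCost (hT : 0 < T) (f : Vec n × Vec m → Vec n) (x₀ : Vec n)
    (K : ℝ → Vec n →L[ℝ] Vec m) (l : ℝ → Vec n × Vec m × Vec p → ℝ) (φ : Vec n × Vec p → ℝ)
    (ρ : Vec p) (ξ : Curve n m T) : ℝ :=
  cost hT l φ (projection hT f x₀ K ξ) ρ

/-- `ξ` is a second order sufficient condition (SSC) local minimizer of the functional `g`: it is
a trajectory and a local minimizer of `g`, and the second derivative of `g` at `ξ` is strongly
positive, with respect to the `L_2` norm, on the tangent space at `ξ`. -/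
def IsSSCLocalMinimizer (hT : 0 < T) (f : Vec n × Vec m → Vec n) (x₀ : Vec n)
    (K : ℝ → Vec n →L[ℝ] Vec m) (g : Curve n m T → ℝ) (ξ : Curve n m T) : Prop :=
  ξ ∈ trajectories hT f x₀ ∧ IsLocalMin g ξ ∧
    ∃ c : ℝ, 0 < c ∧ ∀ ζ ∈ tangentSpace hT f x₀ K ξ,
      c * Curve.sqL2 hT ζ ≤ fderiv ℝ (fderiv ℝ g) ξ ζ ζ

end TrajOpt

end

/-!
The trajectories near a given one are parametrized by their feedforward `v = μ + K α`, an element of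
`L^∞`: the projection of a curve depends on its feedforward only, the feedforward of the projected
curve is the same, and the solution of the feedback system is a `C^2` function of `v`
(`solution_of_mem_solvable`), by the implicit function theorem, since the linearized state equation
is a Volterra equation (`isUnit_one_sub_primitiveOp_comp`). So the functional `g_ρ` is the
composition of a bounded linear map with the cost `inputCost ρ`, which has to be minimized over an
open subset of `L^∞`, without constraints.

The difficulty is the discrepancy of the two norms: the Hessian is coercive in the `L^2` norm, while
the cost is differentiable in the `L^∞` norm only, so that the Hessian is not an isomorphism of
`L^∞` onto its dual. The remedy is that the derivatives with respect to `v` extend to the integrable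
functions. The derivative of the cost is therefore a `C^1` map `gradient` with values in the dual
`(L^1)*`, which is isomorphic to `L^∞` (`pairing_surjective`), and the implicit function theorem can
be applied to the equation `gradient = 0` provided that its derivative `L^∞ → (L^1)*` is an
isomorphism. This holds by `isInvertible_of_coercive`. On pairs of functions with disjoint
supports the Hessian is bounded in the `L^1` norm (`exists_abs_hessian_le`), because there the terms
of the second derivative that are local in time vanish. Testing the equation `B w = q` against the
part of `w` above a high level then bounds `w` in the `L^∞` norm, and the same estimate along the
segment from the duality pairing to the Hessian gives surjectivity.

Coercivity persists under perturbations that are small in `L^∞`, since a symmetric form that is small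
as a map from `L^∞` to `(L^1)*` is small in the `L^2` norm (`exists_abs_le_integral_norm_sq`, an
argument of Lax). Hence the perturbed critical points are local minimizers, as the Hessian is
nonnegative on a whole `L^∞` neighbourhood of each of them, and they satisfy the second order
sufficient condition (`isSSCLocalMinimizer_response`).
-/

noncomputable section

set_option linter.unusedSectionVars false
set_option maxSynthPendingDepth 3

namespace TrajOpt

/-! ### Tools on `Lp` spaces over a finite measure, duality, and quadratic forms -/

section LpTools

variable {Ω : Type*} [MeasurableSpace Ω] {μ : Measure Ω} [IsFiniteMeasure μ]
  {E F : Type*} [NormedAddCommGroup E] [NormedSpace ℝ E] [NormedAddCommGroup F] [NormedSpace ℝ F]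

theorem ae_norm_le_norm (f : Lp E ⊤ μ) : ∀ᵐ t ∂μ, ‖f t‖ ≤ ‖f‖ := by
  filter_upwards [ae_le_eLpNormEssSup (f := f) (μ := μ)] with t ht
  have h := ENNReal.toReal_mono (by simpa using (Lp.memLp f).2.ne) ht
  simpa [Lp.norm_def] using h

theorem norm_le_of_ae_norm_le {f : Lp E ⊤ μ} {C : ℝ} (hC : 0 ≤ C) (h : ∀ᵐ t ∂μ, ‖f t‖ ≤ C) :
    ‖f‖ ≤ C := by
  refine (Lp.norm_le_of_ae_bound hC h).trans (by simp)

/-- The inclusion `L^q ⊆ L^p` for `p ≤ q` over a finite measure, as a continuous linear map. -/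
def lpIncl {p q : ENNReal} [Fact (1 ≤ p)] [Fact (1 ≤ q)] (h : p ≤ q) :
    Lp E q μ →L[ℝ] Lp E p μ :=
  LinearMap.mkContinuous
    { toFun := fun f => ((Lp.memLp f).mono_exponent h).toLp f
      map_add' := fun f g => by
        rw [← MemLp.toLp_add]
        exact MemLp.toLp_congr _ _ (Lp.coeFn_add f g)
      map_smul' := fun c f => by
        rw [RingHom.id_apply, ← MemLp.toLp_const_smul]
        exact MemLp.toLp_congr _ _ (Lp.coeFn_smul c f) }
    (μ univ ^ (1 / p.toReal - 1 / q.toReal)).toReal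
    (fun f => by
      have h0 : 0 ≤ 1 / p.toReal - 1 / q.toReal := by
        rcases eq_or_ne q ⊤ with rfl | hq
        · simp
        · have hp : 1 ≤ p := Fact.out
          have hp' : p ≠ ⊤ := ne_top_of_le_ne_top hq h
          rw [sub_nonneg]
          refine one_div_le_one_div_of_le (ENNReal.toReal_pos (by positivity) hp') ?_
          exact ENNReal.toReal_mono hq h
      simp only [LinearMap.coe_mk, AddHom.coe_mk]
      rw [Lp.norm_toLp, Lp.norm_def, mul_comm, ← ENNReal.toReal_mul]
      refine ENNReal.toReal_mono ?_ (eLpNorm_le_eLpNorm_mul_rpow_measure_univ h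
        (Lp.aestronglyMeasurable f))
      exact ENNReal.mul_ne_top (Lp.memLp f).2.ne
        (ENNReal.rpow_ne_top_of_nonneg h0 (measure_ne_top _ _)))

theorem coeFn_lpIncl {p q : ENNReal} [Fact (1 ≤ p)] [Fact (1 ≤ q)] (h : p ≤ q) (f : Lp E q μ) :
    lpIncl h f =ᵐ[μ] f :=
  MemLp.coeFn_toLp ((Lp.memLp f).mono_exponent h)

/-- The inclusion of `L^∞` in `L^1`. -/
abbrev incl₁ : Lp E ⊤ μ →L[ℝ] Lp E 1 μ := lpIncl le_top

/-- The inclusion of `L^∞` in `L^2`. -/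
abbrev incl₂ : Lp E ⊤ μ →L[ℝ] Lp E 2 μ := lpIncl le_top

theorem norm_incl₁ (w : Lp E ⊤ μ) : ‖(incl₁ w : Lp E 1 μ)‖ = ∫ t, ‖w t‖ ∂μ := by
  rw [L1.norm_eq_integral_norm]
  exact integral_congr_ae ((coeFn_lpIncl _ w).fun_comp norm)

theorem integrable_norm_sq (w : Lp E ⊤ μ) : Integrable (fun t => ‖w t‖ ^ 2) μ :=
  ((Lp.memLp w).mono_exponent le_top).integrable_norm_pow (by norm_num)

theorem integrable_norm (w : Lp E ⊤ μ) : Integrable (fun t => ‖w t‖) μ :=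
  (((Lp.memLp w).mono_exponent le_top).integrable le_rfl).norm

theorem integral_norm_sq_nonneg (w : Lp E ⊤ μ) : 0 ≤ ∫ t, ‖w t‖ ^ 2 ∂μ :=
  integral_nonneg fun _ => sq_nonneg _

/-- Cauchy–Schwarz against the constant function `1`. -/
theorem sq_integral_norm_le (w : Lp E ⊤ μ) :
    (∫ t, ‖w t‖ ∂μ) ^ 2 ≤ μ.real univ * ∫ t, ‖w t‖ ^ 2 ∂μ := by
  set a := ∫ t, ‖w t‖ ∂μ with ha
  set b := ∫ t, ‖w t‖ ^ 2 ∂μ with hb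
  have hb0 : 0 ≤ b := integral_norm_sq_nonneg w
  have hM : 0 ≤ μ.real univ := measureReal_nonneg
  -- the integral of `(‖w‖ - s) ^ 2`, which is least at `s = a / μ(univ)`
  have h : ∀ s : ℝ, 0 ≤ b - 2 * s * a + s ^ 2 * μ.real univ := fun s => by
    have h0 : 0 ≤ ∫ t, (‖w t‖ - s) ^ 2 ∂μ := integral_nonneg fun _ => sq_nonneg _
    have h1 : ∫ t, (‖w t‖ - s) ^ 2 ∂μ = b - 2 * s * a + s ^ 2 * μ.real univ := by
      have : (fun t => (‖w t‖ - s) ^ 2) = fun t => ‖w t‖ ^ 2 - 2 * s * ‖w t‖ + s ^ 2 := by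
        ext t; ring
      have hi : Integrable (fun t => ‖w t‖ ^ 2 - 2 * s * ‖w t‖) μ :=
        (integrable_norm_sq w).sub ((integrable_norm w).const_mul _)
      rw [this, integral_add hi (integrable_const _),
        integral_sub (integrable_norm_sq w) ((integrable_norm w).const_mul _),
        integral_const_mul, integral_const, smul_eq_mul]
      ring
    linarith
  rcases hM.eq_or_lt with hM | hM
  · have hz : μ = 0 := by
      rw [← Measure.measure_univ_eq_zero]
      exact (measureReal_eq_zero_iff).1 hM.symm
    simp [ha, hb, hz]
  · have := h (a / μ.real univ)
    have e : b - 2 * (a / μ.real univ) * a + (a / μ.real univ) ^ 2 * μ.real univ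
        = b - a ^ 2 / μ.real univ := by field_simp; ring
    rw [e, sub_nonneg, div_le_iff₀ hM] at this
    linarith

/-- Two continuous functionals on `L^1` that agree on `L^∞` are equal. -/
theorem ext_incl₁ {f g : Lp E 1 μ →L[ℝ] F}
    (h : ∀ w : Lp E ⊤ μ, f (incl₁ w) = g (incl₁ w)) : f = g := by
  ext z
  refine Lp.induction (p := 1) ENNReal.one_ne_top (fun z => f z = g z) ?_ ?_ ?_ z
  · intro c s hs hμs
    have : (↑(Lp.simpleFunc.indicatorConst 1 hs hμs.ne c) : Lp E 1 μ)
        = incl₁ (indicatorConstLp ⊤ hs hμs.ne c) := by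
      rw [Lp.simpleFunc.coe_indicatorConst]
      refine Lp.ext ?_
      filter_upwards [indicatorConstLp_coeFn (p := 1) (hs := hs) (hμs := hμs.ne) (c := c),
        indicatorConstLp_coeFn (p := ⊤) (hs := hs) (hμs := hμs.ne) (c := c),
        coeFn_lpIncl (p := 1) le_top (indicatorConstLp ⊤ hs hμs.ne c : Lp E ⊤ μ)] with t h1 h2 h3
      rw [h1, h3, h2]
    rw [this, h]
  · intro a b ha hb _ h1 h2
    rw [map_add, map_add, h1, h2]
  · exact isClosed_eq f.continuous g.continuous

/-- A function `w` whose part above the level `k` is, in the mean, at most `k` is bounded by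
`k`. -/
theorem ae_norm_le_of_integral_truncation_le {w : Ω → E} {k : ℝ}
    (h1 : Integrable (fun t => ‖{t | k < ‖w t‖}.indicator w t‖) μ)
    (h2 : Integrable (fun t => ‖{t | k < ‖w t‖}.indicator w t‖ ^ 2) μ) (hk : 0 ≤ k)
    (h : ∫ t, ‖{t | k < ‖w t‖}.indicator w t‖ ^ 2 ∂μ
      ≤ k * ∫ t, ‖{t | k < ‖w t‖}.indicator w t‖ ∂μ) :
    ∀ᵐ t ∂μ, ‖w t‖ ≤ k := by
  set a := {t | k < ‖w t‖}.indicator w with ha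
  have hnn : ∀ t, 0 ≤ ‖a t‖ ^ 2 - k * ‖a t‖ := fun t => by
    by_cases ht : k < ‖w t‖
    · rw [ha, indicator_of_mem (by exact ht)]
      nlinarith
    · rw [ha, indicator_of_notMem (by exact ht)]
      simp
  have hi : ∫ t, (‖a t‖ ^ 2 - k * ‖a t‖) ∂μ = 0 := by
    refine le_antisymm ?_ (integral_nonneg hnn)
    rw [integral_sub h2 (h1.const_mul k), integral_const_mul]
    linarith
  rw [integral_eq_zero_iff_of_nonneg hnn (h2.sub (h1.const_mul k))] at hi
  filter_upwards [hi] with t ht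
  by_contra hlt
  push Not at hlt
  simp only [Pi.zero_apply] at ht
  rw [ha, indicator_of_mem (by exact hlt)] at ht
  nlinarith

end LpTools

section Duality

variable {Ω : Type*} [MeasurableSpace Ω] {μ : Measure Ω} [IsFiniteMeasure μ]
  {H : Type*} [NormedAddCommGroup H] [InnerProductSpace ℝ H] [CompleteSpace H]

/-- The duality pairing `w ↦ (z ↦ ∫ ⟪w, z⟫)` between `L^∞` and `L^1`. -/
def pairing : Lp H ⊤ μ →L[ℝ] (Lp H 1 μ →L[ℝ] ℝ) := (innerSL ℝ).lpPairing μ ⊤ 1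

theorem pairing_apply (w : Lp H ⊤ μ) (z : Lp H 1 μ) :
    pairing w z = ∫ t, inner ℝ (w t) (z t) ∂μ := by
  rw [pairing, ContinuousLinearMap.lpPairing_eq_integral]
  rfl

theorem pairing_incl₁ (w z : Lp H ⊤ μ) :
    pairing w (incl₁ z) = inner ℝ (incl₂ w) (incl₂ z) := by
  rw [pairing_apply, L2.inner_def]
  refine integral_congr_ae ?_
  filter_upwards [coeFn_lpIncl le_top z (p := 1), coeFn_lpIncl le_top z (p := 2),
    coeFn_lpIncl le_top w (p := 2)] with t h1 h2 h3
  rw [h1, h2, h3]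

theorem norm_incl₂_sq (w : Lp H ⊤ μ) : ‖(incl₂ w : Lp H 2 μ)‖ ^ 2 = ∫ t, ‖w t‖ ^ 2 ∂μ := by
  rw [← real_inner_self_eq_norm_sq (incl₂ w), L2.inner_def]
  refine integral_congr_ae ?_
  filter_upwards [coeFn_lpIncl le_top w (p := 2)] with t h
  rw [h, real_inner_self_eq_norm_sq]

theorem pairing_injective : Function.Injective (pairing : Lp H ⊤ μ →L[ℝ] (Lp H 1 μ →L[ℝ] ℝ)) := by
  rw [injective_iff_map_eq_zero]
  intro w hw
  have h0 : ∫ t, ‖w t‖ ^ 2 ∂μ = 0 := by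
    rw [← norm_incl₂_sq, ← real_inner_self_eq_norm_sq, ← pairing_incl₁, hw]
    simp
  rw [integral_eq_zero_iff_of_nonneg (fun _ => sq_nonneg _) (integrable_norm_sq w)] at h0
  refine Lp.ext ?_
  filter_upwards [h0, Lp.coeFn_zero H ⊤ μ] with t ht h1
  rw [h1]
  simpa using ht

/-- The Riesz representation theorem `(L^1)* = L^∞` over a finite measure: the restriction of a
functional to `L^2` is represented by some `w ∈ L^2`, and testing against the part of `w` above the
level `‖q‖` shows that `‖w‖ ≤ ‖q‖` almost everywhere. -/
theorem pairing_surjective :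
    Function.Surjective (pairing : Lp H ⊤ μ →L[ℝ] (Lp H 1 μ →L[ℝ] ℝ)) := by
  intro q
  have h12 : (1 : ENNReal) ≤ 2 := by norm_num
  set w : Lp H 2 μ := (InnerProductSpace.toDual ℝ (Lp H 2 μ)).symm (q ∘L lpIncl h12) with hw
  have hq : ∀ z : Lp H 2 μ, inner ℝ w z = q (lpIncl h12 z) := fun z => by
    rw [hw, InnerProductSpace.toDual_symm_apply]; rfl
  have hA : MeasurableSet {t | ‖q‖ < ‖w t‖} :=
    measurableSet_lt measurable_const (Lp.stronglyMeasurable w).norm.measurable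
  set a := {t | ‖q‖ < ‖w t‖}.indicator w with ha
  have ha2 : MemLp a 2 μ := (Lp.memLp w).indicator hA
  have h1 : Integrable (fun t => ‖a t‖) μ := ((ha2.mono_exponent h12).integrable le_rfl).norm
  have h2 : Integrable (fun t => ‖a t‖ ^ 2) μ := ha2.integrable_norm_pow (by norm_num)
  have hbd : ∀ᵐ t ∂μ, ‖w t‖ ≤ ‖q‖ := by
    refine ae_norm_le_of_integral_truncation_le h1 h2 (norm_nonneg q) ?_
    have e1 : inner ℝ w (ha2.toLp a) = ∫ t, ‖a t‖ ^ 2 ∂μ := by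
      rw [L2.inner_def]
      refine integral_congr_ae ?_
      filter_upwards [ha2.coeFn_toLp] with t ht
      rw [ht, ha]
      by_cases hk : t ∈ {t | ‖q‖ < ‖w t‖}
      · rw [indicator_of_mem hk, real_inner_self_eq_norm_sq]
      · rw [indicator_of_notMem hk]; simp
    have e2 : ‖lpIncl h12 (ha2.toLp a)‖ = ∫ t, ‖a t‖ ∂μ := by
      rw [L1.norm_eq_integral_norm]
      exact integral_congr_ae (((coeFn_lpIncl h12 _).trans ha2.coeFn_toLp).fun_comp norm)
    rw [← e1, hq, ← e2]
    exact (le_abs_self _).trans (q.le_opNorm _)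
  have hw' : MemLp w ⊤ μ := memLp_top_of_bound (Lp.aestronglyMeasurable w) _ hbd
  refine ⟨hw'.toLp w, ext_incl₁ fun z => ?_⟩
  have e3 : (incl₁ z : Lp H 1 μ) = lpIncl h12 (incl₂ z) := by
    refine Lp.ext ?_
    filter_upwards [coeFn_lpIncl le_top z (p := 1), coeFn_lpIncl le_top z (p := 2),
      coeFn_lpIncl h12 (incl₂ z)] with t h1 h2 h3
    rw [h1, h3, h2]
  have e4 : (incl₂ (hw'.toLp w) : Lp H 2 μ) = w :=
    Lp.ext ((coeFn_lpIncl _ _).trans hw'.coeFn_toLp)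
  rw [pairing_incl₁, e4, hq, e3]

/-- The isomorphism `L^∞ ≃ (L^1)*`. -/
def pairingEquiv : Lp H ⊤ μ ≃L[ℝ] (Lp H 1 μ →L[ℝ] ℝ) :=
  ContinuousLinearEquiv.ofBijective (E := Lp H ⊤ μ) (F := Lp H 1 μ →L[ℝ] ℝ)
    (pairing (μ := μ) (H := H))
    (LinearMap.ker_eq_bot_of_injective (pairing_injective (μ := μ) (H := H)))
    (LinearMap.range_eq_top_of_surjective _ (pairing_surjective (μ := μ) (H := H)))

theorem pairingEquiv_apply (w : Lp H ⊤ μ) :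
    (pairingEquiv : Lp H ⊤ μ ≃L[ℝ] (Lp H 1 μ →L[ℝ] ℝ)) w = pairing w := rfl

end Duality

section BoundedInverse

variable {X Y : Type*} [NormedAddCommGroup X] [NormedSpace ℝ X] [CompleteSpace X]
  [NormedAddCommGroup Y] [NormedSpace ℝ Y]

/-- The method of continuity: if the operators `1 + s D`, `0 ≤ s ≤ 1`, are bounded below by a common
constant, then `1 + D` is invertible. -/
theorem isUnit_one_add_of_norm_le {D : X →L[ℝ] X} {C : ℝ}
    (h : ∀ s ∈ Icc (0 : ℝ) 1, ∀ x, ‖x‖ ≤ C * ‖x + s • D x‖) : IsUnit (1 + D) := by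
  obtain ⟨C', hC', hCC'⟩ : ∃ C' : ℝ, 0 < C' ∧ C ≤ C' := ⟨max C 1, by positivity, le_max_left _ _⟩
  replace h : ∀ s ∈ Icc (0 : ℝ) 1, ∀ x, ‖x‖ ≤ C' * ‖x + s • D x‖ := fun s hs x =>
    (h s hs x).trans (mul_le_mul_of_nonneg_right hCC' (norm_nonneg _))
  -- a step of length less than `1 / (C' ‖D‖)` stays among the units
  have step : ∀ s ∈ Icc (0 : ℝ) 1, ∀ r ∈ Icc (0 : ℝ) 1, |r - s| * ‖D‖ * C' < 1 →
      IsUnit (1 + s • D) → IsUnit (1 + r • D) := by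
    rintro s hs r - hrs ⟨u, hu⟩
    have hinv : ‖((r - s) • D) * (↑u⁻¹ : X →L[ℝ] X)‖ < 1 := by
      have h1 : ‖(↑u⁻¹ : X →L[ℝ] X)‖ ≤ C' := by
        refine ContinuousLinearMap.opNorm_le_bound _ hC'.le fun y => ?_
        have h2 : (u : X →L[ℝ] X) ((↑u⁻¹ : X →L[ℝ] X) y) = y := by
          rw [← mul_apply_eq_comp, Units.mul_inv]; rfl
        have h3 := h s hs ((↑u⁻¹ : X →L[ℝ] X) y)
        rw [hu] at h2
        have h4 : (↑u⁻¹ : X →L[ℝ] X) y + s • D ((↑u⁻¹ : X →L[ℝ] X) y) = y := by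
          simpa using h2
        rwa [h4] at h3
      calc ‖((r - s) • D) * (↑u⁻¹ : X →L[ℝ] X)‖ ≤ ‖(r - s) • D‖ * ‖(↑u⁻¹ : X →L[ℝ] X)‖ :=
            norm_mul_le _ _
        _ ≤ |r - s| * ‖D‖ * C' := by
            rw [norm_smul, Real.norm_eq_abs]
            gcongr
        _ < 1 := hrs
    have h5 : 1 + r • D = (1 - -(((r - s) • D) * (↑u⁻¹ : X →L[ℝ] X))) * u := by
      rw [sub_neg_eq_add, add_mul, mul_assoc, Units.inv_mul, hu, sub_smul]
      simp
    rw [h5]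
    exact (isUnit_one_sub_of_norm_lt_one (by rwa [norm_neg])).mul u.isUnit
  obtain ⟨N, hN⟩ := exists_nat_gt (‖D‖ * C')
  have hN0 : (0 : ℝ) < N := lt_of_le_of_lt (by positivity) hN
  have main : ∀ k : ℕ, k ≤ N → IsUnit (1 + ((k : ℝ) / N) • D) := by
    intro k
    induction k with
    | zero => intro _; simp
    | succ k ih =>
      intro hk
      have hk' : (k : ℝ) + 1 ≤ N := by exact_mod_cast hk
      refine step (k / N) ⟨by positivity, ?_⟩ _ ⟨by positivity, ?_⟩ ?_ (ih (by omega))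
      · rw [div_le_one hN0]; linarith
      · rw [div_le_one hN0]; push_cast; linarith
      · have : ((k + 1 : ℕ) : ℝ) / N - k / N = 1 / N := by push_cast; ring
        rw [this, abs_of_pos (by positivity), mul_assoc, one_div_mul_eq_div, div_lt_one hN0]
        exact hN
  have := main N le_rfl
  rwa [div_self hN0.ne', one_smul] at this

/-- The method of continuity between two spaces: an operator `B` that can be joined to an
isomorphism `R` by a segment of operators that are bounded below by a common constant is
invertible. -/
theorem isInvertible_of_norm_le (R : X ≃L[ℝ] Y) (B : X →L[ℝ] Y) {C : ℝ}
    (h : ∀ s ∈ Icc (0 : ℝ) 1, ∀ x, ‖x‖ ≤ C * ‖(1 - s) • R x + s • B x‖) : B.IsInvertible := by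
  set D : X →L[ℝ] X := (R.symm : Y →L[ℝ] X) ∘L B - 1 with hD
  have key : IsUnit (1 + D) := by
    refine isUnit_one_add_of_norm_le (C := |C| * ‖(R : X →L[ℝ] Y)‖) fun s hs x => ?_
    have e : (1 - s) • R x + s • B x = (R : X →L[ℝ] Y) (x + s • D x) := by
      simp [hD, sub_smul, smul_sub]
      abel
    calc ‖x‖ ≤ C * ‖(1 - s) • R x + s • B x‖ := h s hs x
      _ ≤ |C| * (‖(R : X →L[ℝ] Y)‖ * ‖x + s • D x‖) := by
          rw [e]
          exact mul_le_mul (le_abs_self C) (ContinuousLinearMap.le_opNorm _ _) (norm_nonneg _)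
            (abs_nonneg C)
      _ = _ := by ring
  obtain ⟨u, hu⟩ := key
  refine ⟨(ContinuousLinearEquiv.unitsEquiv ℝ X u).trans R, ?_⟩
  ext x
  have : (u : X →L[ℝ] X) x = R.symm (B x) := by rw [hu, hD]; simp
  simp [this]

end BoundedInverse

section QuadraticForms

variable {Ω : Type*} [MeasurableSpace Ω] {μ : Measure Ω} [IsFiniteMeasure μ]
  {H : Type*} [NormedAddCommGroup H] [InnerProductSpace ℝ H] [CompleteSpace H]

/-- A log-convex sequence `a` with `a k ≤ A N ^ k` satisfies `a 1 ≤ N * a 0`. -/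
theorem le_mul_of_sq_le_mul {a : ℕ → ℝ} {A N : ℝ} (ha : ∀ k, 0 ≤ a k) (hN : 0 ≤ N)
    (hconv : ∀ k, a (k + 1) ^ 2 ≤ a k * a (k + 2)) (hbd : ∀ k, a k ≤ A * N ^ k) :
    a 1 ≤ N * a 0 := by
  by_contra! hlt
  have h0 : 0 < a 0 := by
    rcases (ha 0).eq_or_lt with h | h
    · have := hconv 0
      rw [← h] at this hlt
      simp only [zero_add, zero_mul, mul_zero] at this hlt
      nlinarith
    · exact h
  have h1 : 0 < a 1 := lt_of_le_of_lt (by positivity) hlt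
  have hq : N < a 1 / a 0 := by rwa [lt_div_iff₀ h0]
  set q := a 1 / a 0 with hqdef
  have hq0 : 0 < q := by positivity
  have hstep : ∀ k, 0 < a k ∧ q * a k ≤ a (k + 1) := by
    intro k
    induction k with
    | zero => exact ⟨h0, by rw [hqdef, div_mul_cancel₀ _ h0.ne']⟩
    | succ k ih =>
      have hp : 0 < a (k + 1) := lt_of_lt_of_le (mul_pos hq0 ih.1) ih.2
      refine ⟨hp, ?_⟩
      have h2 := hconv k
      have h3 : a (k + 1) * (q * a k) ≤ a (k + 1) * a (k + 1) :=
        mul_le_mul_of_nonneg_left ih.2 hp.le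
      refine le_of_mul_le_mul_left ?_ ih.1
      show a k * (q * a (k + 1)) ≤ a k * a (k + 2)
      nlinarith
  have hgrow : ∀ k, q ^ k * a 0 ≤ a k := by
    intro k
    induction k with
    | zero => simp
    | succ k ih =>
      calc q ^ (k + 1) * a 0 = q * (q ^ k * a 0) := by ring
        _ ≤ q * a k := by gcongr
        _ ≤ a (k + 1) := (hstep k).2
  rcases hN.eq_or_lt with rfl | hN
  · have := hbd 1
    simp at this
    linarith
  · have hr : 1 < q / N := by rwa [one_lt_div hN]
    obtain ⟨k, hk⟩ := pow_unbounded_of_one_lt (A / a 0) hr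
    have h4 := (hgrow k).trans (hbd k)
    rw [div_pow, div_lt_div_iff₀ h0 (by positivity)] at hk
    linarith

/-- A symmetric bilinear form which is bounded as a map from `L^∞` to `(L^1)*` is bounded in the
`L^2` norm: `(L^1)* = L^∞`, and an operator `b` on `L^∞` that is symmetric in `L^2` satisfies
`‖b^{k+1} w‖₂ ^ 2 ≤ ‖b^k w‖₂ ‖b^{k+2} w‖₂`, whence `‖b w‖₂ ≤ ‖b‖ ‖w‖₂`. -/
theorem exists_abs_le_integral_norm_sq :
    ∃ C : ℝ, 0 < C ∧ ∀ B : Lp H ⊤ μ →L[ℝ] (Lp H 1 μ →L[ℝ] ℝ),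
      (∀ w z, B w (incl₁ z) = B z (incl₁ w)) →
      ∀ w, |B w (incl₁ w)| ≤ C * ‖B‖ * ∫ t, ‖w t‖ ^ 2 ∂μ := by
  set R : (Lp H 1 μ →L[ℝ] ℝ) →L[ℝ] Lp H ⊤ μ :=
    ((pairingEquiv : Lp H ⊤ μ ≃L[ℝ] (Lp H 1 μ →L[ℝ] ℝ)).symm :
      (Lp H 1 μ →L[ℝ] ℝ) →L[ℝ] Lp H ⊤ μ) with hR
  refine ⟨‖R‖ + 1, by positivity, fun B hB w => ?_⟩
  set b : Lp H ⊤ μ →L[ℝ] Lp H ⊤ μ := R ∘L B with hb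
  have hbB : ∀ w z, B w (incl₁ z) = inner ℝ (incl₂ (b w)) (incl₂ z) := fun w z => by
    rw [← pairing_incl₁]
    have : pairing (b w) = B w := by
      rw [← pairingEquiv_apply, hb, hR]
      exact pairingEquiv.apply_symm_apply (B w)
    rw [this]
  have hsymm : ∀ w z, inner ℝ (incl₂ (b w)) (incl₂ z) = inner ℝ (incl₂ w) (incl₂ (b z)) :=
    fun w z => by rw [← hbB, hB, hbB, real_inner_comm]
  have hnb : ‖b‖ ≤ ‖R‖ * ‖B‖ := ContinuousLinearMap.opNorm_comp_le _ _
  set J : Lp H ⊤ μ →L[ℝ] Lp H 2 μ := incl₂ with hJ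
  have key : ‖J ((b ^ 1) w)‖ ≤ ‖b‖ * ‖J ((b ^ 0) w)‖ := by
    refine le_mul_of_sq_le_mul (a := fun k => ‖J ((b ^ k) w)‖) (A := ‖J‖ * ‖w‖)
      (fun k => norm_nonneg _) (norm_nonneg b) (fun k => ?_) (fun k => ?_)
    · rw [← real_inner_self_eq_norm_sq, pow_succ' b k]
      have h1 : (b * b ^ k) w = b ((b ^ k) w) := rfl
      have h2 : (b ^ (k + 2)) w = b ((b * b ^ k) w) := by rw [pow_succ', pow_succ']; rfl
      rw [h2, h1, hsymm]
      exact real_inner_le_norm _ _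
    · calc ‖J ((b ^ k) w)‖ ≤ ‖J‖ * ‖(b ^ k) w‖ := J.le_opNorm _
        _ ≤ ‖J‖ * (‖b‖ ^ k * ‖w‖) := by
            gcongr
            refine ((b ^ k).le_opNorm w).trans ?_
            gcongr
            rcases Nat.eq_zero_or_pos k with rfl | hk
            · rw [pow_zero, pow_zero]; exact ContinuousLinearMap.norm_id_le
            · exact norm_pow_le' b hk
        _ = _ := by ring
  simp only [pow_one, pow_zero, one_apply_eq_self] at key
  calc |B w (incl₁ w)| = |inner ℝ (J (b w)) (J w)| := by rw [hbB]
    _ ≤ ‖J (b w)‖ * ‖J w‖ := abs_real_inner_le_norm _ _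
    _ ≤ (‖b‖ * ‖J w‖) * ‖J w‖ := by gcongr
    _ = ‖b‖ * ∫ t, ‖w t‖ ^ 2 ∂μ := by rw [← norm_incl₂_sq]; ring
    _ ≤ (‖R‖ + 1) * ‖B‖ * ∫ t, ‖w t‖ ^ 2 ∂μ := by
        have := integral_norm_sq_nonneg w
        gcongr
        nlinarith [norm_nonneg B]

/-- Let the bilinear form `B` be coercive in the `L^2` norm, and bounded in the `L^1` norm on pairs
of functions with disjoint supports. Then `‖w‖_∞ ≤ C ‖B w‖`: this is seen by testing `B w` against
`w` and then against the part of `w` above a level. -/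
theorem exists_norm_le_of_coercive {c M : ℝ} (hc : 0 < c) (hM : 0 ≤ M) :
    ∃ C : ℝ, ∀ B : Lp H ⊤ μ →L[ℝ] (Lp H 1 μ →L[ℝ] ℝ),
      (∀ w, c * ∫ t, ‖w t‖ ^ 2 ∂μ ≤ B w (incl₁ w)) →
      (∀ w z : Lp H ⊤ μ, (∀ᵐ t ∂μ, w t = 0 ∨ z t = 0) →
        |B w (incl₁ z)| ≤ M * (∫ t, ‖w t‖ ∂μ) * ∫ t, ‖z t‖ ∂μ) →
      ∀ w, ‖w‖ ≤ C * ‖B w‖ := by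
  refine ⟨(1 + M * (μ.real univ / c)) / c, fun B hcoer hdisj w => ?_⟩
  set q := ‖B w‖ with hq
  have hBw : ∀ z, |B w (incl₁ z)| ≤ q * ∫ t, ‖z t‖ ∂μ := fun z => by
    rw [← norm_incl₁]; exact (B w).le_opNorm _
  set s := ∫ t, ‖w t‖ ^ 2 ∂μ with hs
  set a₁ := ∫ t, ‖w t‖ ∂μ with ha₁
  have ha₁0 : 0 ≤ a₁ := integral_nonneg fun _ => norm_nonneg _
  have hq0 : 0 ≤ q := norm_nonneg _
  have hV : 0 ≤ μ.real univ := measureReal_nonneg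
  -- testing `B w` against `w` bounds `w` in the `L^1` norm
  have h1 : a₁ ≤ μ.real univ / c * q := by
    have e1 : c * s ≤ q * a₁ := (hcoer w).trans ((le_abs_self _).trans (hBw w))
    have e2 : a₁ ^ 2 ≤ μ.real univ * s := sq_integral_norm_le w
    rcases ha₁0.eq_or_lt with h | h
    · rw [← h]; positivity
    · rw [div_mul_eq_mul_div, le_div_iff₀ hc]
      have e3 : c * a₁ ^ 2 ≤ μ.real univ * (q * a₁) := by
        nlinarith [mul_le_mul_of_nonneg_left e1 hV]
      refine le_of_mul_le_mul_right ?_ h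
      linarith
  -- at this level the part `a` of `w` above it satisfies `c ‖a‖₂² ≤ B a a ≤ c k ‖a‖₁`, as the rest of
  -- `w` has a support disjoint from that of `a`
  set k := (q + M * a₁) / c with hk
  have hk0 : 0 ≤ k := by positivity
  have hA : MeasurableSet {t | k < ‖w t‖} :=
    measurableSet_lt measurable_const (Lp.stronglyMeasurable w).norm.measurable
  have ha : MemLp ({t | k < ‖w t‖}.indicator w) ⊤ μ := (Lp.memLp w).indicator hA
  set a : Lp H ⊤ μ := ha.toLp _ with hadef
  have hae : a =ᵐ[μ] {t | k < ‖w t‖}.indicator w := ha.coeFn_toLp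
  have hdis : ∀ᵐ t ∂μ, (w - a) t = 0 ∨ a t = 0 := by
    filter_upwards [hae, Lp.coeFn_sub w a] with t ht hsub
    by_cases h : t ∈ {t | k < ‖w t‖}
    · left
      rw [hsub, Pi.sub_apply, ht, indicator_of_mem h, sub_self]
    · right
      rw [ht, indicator_of_notMem h]
  have hwa : ∫ t, ‖(w - a) t‖ ∂μ ≤ a₁ := by
    refine integral_mono_ae (integrable_norm _) (integrable_norm _) ?_
    filter_upwards [hae, Lp.coeFn_sub w a] with t ht hsub
    show ‖(w - a) t‖ ≤ ‖w t‖
    rw [hsub, Pi.sub_apply, ht]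
    by_cases h : t ∈ {t | k < ‖w t‖}
    · rw [indicator_of_mem h, sub_self, norm_zero]; exact norm_nonneg _
    · rw [indicator_of_notMem h, sub_zero]
  have hmain : ∫ t, ‖a t‖ ^ 2 ∂μ ≤ k * ∫ t, ‖a t‖ ∂μ := by
    have hi : 0 ≤ ∫ t, ‖a t‖ ∂μ := integral_nonneg fun _ => norm_nonneg _
    have e1 : B a (incl₁ a) = B w (incl₁ a) - B (w - a) (incl₁ a) := by
      rw [map_sub, sub_apply]; ring
    have e2 := hcoer a
    have e3 := (abs_le.1 (hBw a)).2
    have e4 := (abs_le.1 (hdisj _ _ hdis)).1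
    have e5 : M * (∫ t, ‖(w - a) t‖ ∂μ) * (∫ t, ‖a t‖ ∂μ) ≤ M * a₁ * ∫ t, ‖a t‖ ∂μ := by
      gcongr
    rw [hk, div_mul_eq_mul_div, le_div_iff₀ hc]
    nlinarith
  have hbd : ∀ᵐ t ∂μ, ‖w t‖ ≤ k := by
    have c1 : (fun t => ‖a t‖) =ᵐ[μ] fun t => ‖{t | k < ‖w t‖}.indicator w t‖ :=
      hae.fun_comp norm
    have c2 : (fun t => ‖a t‖ ^ 2) =ᵐ[μ] fun t => ‖{t | k < ‖w t‖}.indicator w t‖ ^ 2 :=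
      hae.fun_comp (fun x => ‖x‖ ^ 2)
    refine ae_norm_le_of_integral_truncation_le ((integrable_norm a).congr c1)
      ((integrable_norm_sq a).congr c2) hk0 ?_
    rw [← integral_congr_ae c1, ← integral_congr_ae c2]
    exact hmain
  refine (norm_le_of_ae_norm_le hk0 hbd).trans ?_
  rw [hk, div_mul_eq_mul_div]
  gcongr
  nlinarith [mul_le_mul_of_nonneg_left h1 hM]

/-- A bilinear form that is coercive in the `L^2` norm and bounded in the `L^1` norm on pairs of
functions with disjoint supports defines an isomorphism from `L^∞` to `(L^1)*`. The segment from
the duality pairing to the form consists of such forms, so the method of continuity applies. -/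
theorem isInvertible_of_coercive {c M : ℝ} (hc : 0 < c)
    (B : Lp H ⊤ μ →L[ℝ] (Lp H 1 μ →L[ℝ] ℝ))
    (hcoer : ∀ w, c * ∫ t, ‖w t‖ ^ 2 ∂μ ≤ B w (incl₁ w))
    (hdisj : ∀ w z : Lp H ⊤ μ, (∀ᵐ t ∂μ, w t = 0 ∨ z t = 0) →
        |B w (incl₁ z)| ≤ M * (∫ t, ‖w t‖ ∂μ) * ∫ t, ‖z t‖ ∂μ) : B.IsInvertible := by
  obtain ⟨C, hC⟩ := exists_norm_le_of_coercive (μ := μ) (H := H) (c := min 1 c) (M := |M|)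
    (lt_min one_pos hc) (abs_nonneg M)
  refine isInvertible_of_norm_le (X := Lp H ⊤ μ) (Y := Lp H 1 μ →L[ℝ] ℝ) pairingEquiv B (C := C)
    fun s hs w => ?_
  set Bs : Lp H ⊤ μ →L[ℝ] (Lp H 1 μ →L[ℝ] ℝ) := (1 - s) • pairing + s • B with hBs
  have happ : ∀ w z, Bs w z = (1 - s) * pairing w z + s * B w z := fun _ _ => rfl
  have key := hC Bs (fun w => ?_) (fun w z hwz => ?_) w
  · rw [pairingEquiv_apply]
    exact key
  · have h1 : pairing w (incl₁ w) = ∫ t, ‖w t‖ ^ 2 ∂μ := by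
      rw [pairing_incl₁, real_inner_self_eq_norm_sq, norm_incl₂_sq]
    have h2 := hcoer w
    have h3 := integral_norm_sq_nonneg w
    rw [happ, h1]
    nlinarith [mul_le_mul_of_nonneg_left h2 hs.1, hs.1, hs.2,
      mul_le_mul_of_nonneg_right (min_le_left 1 c) h3,
      mul_le_mul_of_nonneg_right (min_le_right 1 c) h3]
  · have h1 : pairing w (incl₁ z) = 0 := by
      rw [pairing_apply]
      refine integral_eq_zero_of_ae ?_
      filter_upwards [hwz, coeFn_lpIncl le_top z (p := 1)] with t ht hz
      rw [hz]
      rcases ht with h | h <;> simp [h]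
    have h2 := hdisj w z hwz
    have hw : 0 ≤ ∫ t, ‖w t‖ ∂μ := integral_nonneg fun _ => norm_nonneg _
    have hz : 0 ≤ ∫ t, ‖z t‖ ∂μ := integral_nonneg fun _ => norm_nonneg _
    rw [happ, h1, mul_zero, zero_add, abs_mul, abs_of_nonneg hs.1]
    calc s * |B w (incl₁ z)| ≤ 1 * |B w (incl₁ z)| := by gcongr; exact hs.2
      _ ≤ M * (∫ t, ‖w t‖ ∂μ) * ∫ t, ‖z t‖ ∂μ := by rw [one_mul]; exact h2
      _ ≤ _ := by gcongr; exact le_abs_self M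

end QuadraticForms

/-! ### Pointwise multiplication and superposition operators -/

section Multiplication

variable {Ω : Type*} [MeasurableSpace Ω] {μ : Measure Ω}
  {Z W : Type*} [NormedAddCommGroup Z] [NormedSpace ℝ Z] [NormedAddCommGroup W] [NormedSpace ℝ W]
  {p : ENNReal} [Fact (1 ≤ p)]

/-- The pointwise application of an `L^∞` field of operators to an `L^p` function. -/
def mulOp (p : ENNReal) [Fact (1 ≤ p)] :
    Lp (Z →L[ℝ] W) ⊤ μ →L[ℝ] (Lp Z p μ →L[ℝ] Lp W p μ) :=
  (ContinuousLinearMap.id ℝ (Z →L[ℝ] W)).holderL μ ⊤ p p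

theorem coeFn_mulOp (a : Lp (Z →L[ℝ] W) ⊤ μ) (z : Lp Z p μ) :
    mulOp p a z =ᵐ[μ] fun t => a t (z t) :=
  (ContinuousLinearMap.id ℝ (Z →L[ℝ] W)).coeFn_holder a z

theorem mulOp_incl₁ [IsFiniteMeasure μ] (a : Lp (Z →L[ℝ] W) ⊤ μ) (z : Lp Z ⊤ μ) :
    mulOp 1 a (incl₁ z) = incl₁ (mulOp ⊤ a z) := by
  refine Lp.ext ?_
  filter_upwards [coeFn_mulOp a (incl₁ z), coeFn_lpIncl le_top z (p := 1),
    coeFn_lpIncl le_top (mulOp ⊤ a z) (p := 1), coeFn_mulOp a z] with t h1 h2 h3 h4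
  rw [h1, h2, h3, h4]

end Multiplication

/-- Lebesgue measure on the time interval. -/
abbrev timeMeasure (T : ℝ) : Measure ℝ := volume.restrict (Icc (0 : ℝ) T)

theorem ae_mem_Icc (T : ℝ) : ∀ᵐ t ∂(timeMeasure T), t ∈ Icc (0 : ℝ) T :=
  ae_restrict_mem measurableSet_Icc

section Nemytskii

variable {T : ℝ} {Z W : Type*} [NormedAddCommGroup Z] [NormedSpace ℝ Z] [ProperSpace Z]
  [NormedAddCommGroup W] [NormedSpace ℝ W] {φ : ℝ → Z → W}

theorem memLp_nemytskii (hφ : Continuous (Function.uncurry φ)) (z : Lp Z ⊤ (timeMeasure T)) :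
    MemLp (fun t => φ t (z t)) ⊤ (timeMeasure T) := by
  have hm : AEStronglyMeasurable (fun t => φ t (z t)) (timeMeasure T) :=
    hφ.comp_aestronglyMeasurable (f := fun t => (t, z t))
      (aestronglyMeasurable_id.prodMk (Lp.aestronglyMeasurable z))
  obtain ⟨C, hC⟩ := ((isCompact_Icc (a := (0 : ℝ)) (b := T)).prod
    (isCompact_closedBall (0 : Z) ‖z‖)).exists_bound_of_continuousOn hφ.continuousOn
  refine memLp_top_of_bound hm C ?_
  filter_upwards [ae_mem_Icc T, ae_norm_le_norm z] with t ht hz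
  exact hC (t, z t) ⟨ht, by simpa using hz⟩

/-- The Nemytskii (superposition) operator `z ↦ φ(·, z(·))` on `L^∞`. -/
def nemytskii (hφ : Continuous (Function.uncurry φ)) (z : Lp Z ⊤ (timeMeasure T)) :
    Lp W ⊤ (timeMeasure T) :=
  (memLp_nemytskii hφ z).toLp

theorem coeFn_nemytskii (hφ : Continuous (Function.uncurry φ)) (z : Lp Z ⊤ (timeMeasure T)) :
    nemytskii hφ z =ᵐ[timeMeasure T] fun t => φ t (z t) :=
  MemLp.coeFn_toLp _

/-- Continuity in `y`, uniformly in `t ∈ [0, T]` and in `y` from a ball. -/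
theorem exists_forall_norm_sub_le (T : ℝ) (hφ : Continuous (Function.uncurry φ)) (R : ℝ) {ε : ℝ}
    (hε : 0 < ε) : ∃ δ > 0, ∀ t ∈ Icc (0 : ℝ) T, ∀ y y' : Z, ‖y‖ ≤ R → ‖y' - y‖ < δ →
      ‖φ t y' - φ t y‖ ≤ ε := by
  have hu := ((isCompact_Icc (a := (0 : ℝ)) (b := T)).prod
    (isCompact_closedBall (0 : Z) (R + 1))).uniformContinuousOn_of_continuous hφ.continuousOn
  obtain ⟨δ, hδ, h⟩ := Metric.uniformContinuousOn_iff.1 hu ε hε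
  refine ⟨min δ 1, by positivity, fun t ht y y' hy hyy' => ?_⟩
  have hy' : ‖y'‖ ≤ R + 1 := by
    have := norm_add_le (y' - y) y
    rw [sub_add_cancel] at this
    have := hyy'.trans_le (min_le_right δ 1)
    linarith
  have := h (t, y') ⟨ht, by simpa using hy'⟩ (t, y) ⟨ht, by simpa using by linarith⟩
    (by
      rw [Prod.dist_eq, dist_self, max_eq_right dist_nonneg, dist_eq_norm]
      exact hyy'.trans_le (min_le_left _ _))
  rw [dist_eq_norm] at this
  exact this.le

theorem continuous_nemytskii (hφ : Continuous (Function.uncurry φ)) :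
    Continuous (nemytskii hφ : Lp Z ⊤ (timeMeasure T) → Lp W ⊤ (timeMeasure T)) := by
  rw [Metric.continuous_iff]
  intro z ε hε
  obtain ⟨δ, hδ, h⟩ := exists_forall_norm_sub_le T hφ ‖z‖ (half_pos hε)
  refine ⟨δ, hδ, fun y hy => ?_⟩
  rw [dist_eq_norm] at hy ⊢
  refine lt_of_le_of_lt (norm_le_of_ae_norm_le (half_pos hε).le ?_) (half_lt_self hε)
  filter_upwards [ae_mem_Icc T, ae_norm_le_norm z, ae_norm_le_norm (y - z), Lp.coeFn_sub y z,
    coeFn_nemytskii hφ y, coeFn_nemytskii hφ z, Lp.coeFn_sub (nemytskii hφ y) (nemytskii hφ z)]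
    with t ht hz hyz h1 h2 h3 h4
  rw [h4, Pi.sub_apply, h2, h3]
  refine h t ht _ _ hz (lt_of_le_of_lt ?_ hy)
  rwa [h1, Pi.sub_apply] at hyz

/-- The derivative of a superposition operator on `L^∞` is the pointwise application of the derivative
of the function: its remainder is uniformly small by the mean value inequality. -/
theorem hasFDerivAt_nemytskii {φ' : ℝ → Z → Z →L[ℝ] W} (hφ : Continuous (Function.uncurry φ))
    (hφ' : Continuous (Function.uncurry φ')) (hd : ∀ t z, HasFDerivAt (φ t) (φ' t z) z)
    (z : Lp Z ⊤ (timeMeasure T)) :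
    HasFDerivAt (nemytskii hφ : Lp Z ⊤ (timeMeasure T) → Lp W ⊤ (timeMeasure T))
      (mulOp ⊤ (nemytskii hφ' z)) z := by
  rw [hasFDerivAt_iff_isLittleO, Asymptotics.isLittleO_iff]
  intro ε hε
  obtain ⟨δ, hδ, h⟩ := exists_forall_norm_sub_le T hφ' ‖z‖ hε
  filter_upwards [Metric.ball_mem_nhds z hδ] with y hy
  rw [Metric.mem_ball, dist_eq_norm] at hy
  refine norm_le_of_ae_norm_le (by positivity) ?_
  filter_upwards [ae_mem_Icc T, ae_norm_le_norm z, ae_norm_le_norm (y - z), Lp.coeFn_sub y z,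
    coeFn_nemytskii hφ y, coeFn_nemytskii hφ z, Lp.coeFn_sub (nemytskii hφ y) (nemytskii hφ z),
    coeFn_nemytskii hφ' z, coeFn_mulOp (nemytskii hφ' z) (y - z),
    Lp.coeFn_sub (nemytskii hφ y - nemytskii hφ z) (mulOp ⊤ (nemytskii hφ' z) (y - z))]
    with t ht hz hyz h1 h2 h3 h4 h5 h6 h7
  rw [h7, Pi.sub_apply, h4, Pi.sub_apply, h2, h3, h6, h5, h1, Pi.sub_apply]
  rw [h1, Pi.sub_apply] at hyz
  have hball : ‖y t - z t‖ < δ := hyz.trans_lt hy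
  refine ((convex_ball (z t) δ).norm_image_sub_le_of_norm_hasFDerivWithin_le'
    (f := φ t) (f' := φ' t) (fun x _ => (hd t x).hasFDerivWithinAt)
    (fun x hx => h t ht _ _ hz ?_) (Metric.mem_ball_self hδ) ?_).trans ?_
  · rwa [Metric.mem_ball, dist_eq_norm] at hx
  · rwa [Metric.mem_ball, dist_eq_norm]
  · gcongr

/-- A family `φ t` of `C^2` functions which is jointly continuous in `(t, z)`, together with its
derivatives in `z` up to order two. -/
structure ContDiffTwoFamily (φ : ℝ → Z → W) : Prop where
  contDiff : ∀ t, ContDiff ℝ 2 (φ t)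
  cont : Continuous (Function.uncurry φ)
  cont_fderiv : Continuous (Function.uncurry fun t => fderiv ℝ (φ t))
  cont_fderiv_fderiv : Continuous (Function.uncurry fun t => fderiv ℝ (fderiv ℝ (φ t)))

namespace ContDiffTwoFamily

variable (h : ContDiffTwoFamily φ)

theorem hasFDerivAt_nemytskii (z : Lp Z ⊤ (timeMeasure T)) :
    HasFDerivAt (nemytskii h.cont : Lp Z ⊤ (timeMeasure T) → Lp W ⊤ (timeMeasure T))
      (mulOp ⊤ (nemytskii h.cont_fderiv z)) z :=
  TrajOpt.hasFDerivAt_nemytskii _ _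
    (fun t z => ((h.contDiff t).differentiable (by norm_num) z).hasFDerivAt) z

theorem hasFDerivAt_nemytskii_fderiv (z : Lp Z ⊤ (timeMeasure T)) :
    HasFDerivAt
      (nemytskii h.cont_fderiv : Lp Z ⊤ (timeMeasure T) → Lp (Z →L[ℝ] W) ⊤ (timeMeasure T))
      (mulOp ⊤ (nemytskii h.cont_fderiv_fderiv z)) z :=
  TrajOpt.hasFDerivAt_nemytskii _ _
    (fun t z => (((h.contDiff t).fderiv_right (m := 1) (by norm_num)).differentiable
      (by norm_num) z).hasFDerivAt) z

theorem contDiff_nemytskii_fderiv :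
    ContDiff ℝ 1
      (nemytskii h.cont_fderiv : Lp Z ⊤ (timeMeasure T) → Lp (Z →L[ℝ] W) ⊤ (timeMeasure T)) :=
  contDiff_one_iff_hasFDerivAt.2 ⟨fun z => mulOp ⊤ (nemytskii h.cont_fderiv_fderiv z),
    (mulOp ⊤).continuous.comp (continuous_nemytskii _), h.hasFDerivAt_nemytskii_fderiv⟩

theorem contDiff_nemytskii :
    ContDiff ℝ 2 (nemytskii h.cont : Lp Z ⊤ (timeMeasure T) → Lp W ⊤ (timeMeasure T)) := by
  have h1 : ContDiff ℝ 1 fun z : Lp Z ⊤ (timeMeasure T) =>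
      (mulOp ⊤ (nemytskii h.cont_fderiv z) :
        Lp Z ⊤ (timeMeasure T) →L[ℝ] Lp W ⊤ (timeMeasure T)) :=
    (mulOp (Z := Z) (W := W) (μ := timeMeasure T) ⊤).contDiff.comp h.contDiff_nemytskii_fderiv
  have h1 : ContDiff ℝ ((1 : ℕ) : WithTop ℕ∞) fun z : Lp Z ⊤ (timeMeasure T) =>
      (mulOp ⊤ (nemytskii h.cont_fderiv z) :
        Lp Z ⊤ (timeMeasure T) →L[ℝ] Lp W ⊤ (timeMeasure T)) := by exact_mod_cast h1
  exact_mod_cast contDiff_succ_iff_hasFDerivAt.2 ⟨_, h1, h.hasFDerivAt_nemytskii⟩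

end ContDiffTwoFamily

/-- A single `C^2` function, as a family. -/
theorem contDiffTwoFamily_const {f : Z → W} (hf : ContDiff ℝ 2 f) :
    ContDiffTwoFamily fun _ : ℝ => f where
  contDiff _ := hf
  cont := hf.continuous.comp continuous_snd
  cont_fderiv := (hf.continuous_fderiv (by norm_num)).comp continuous_snd
  cont_fderiv_fderiv := ((hf.fderiv_right (m := 1) (by norm_num)).continuous_fderiv
    (by norm_num)).comp continuous_snd

/-- A family given on `[0, T]`, extended to all times by its values at the endpoints. -/
theorem contDiffTwoFamily_projIcc (hT : 0 ≤ T) {l : ℝ → Z → W}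
    (hl : ∀ t ∈ Icc (0 : ℝ) T, ContDiff ℝ 2 (l t))
    (hc : ∀ k : ℕ, k ≤ 2 → ContinuousOn (fun q : ℝ × Z => iteratedFDeriv ℝ k (l q.1) q.2)
      (Icc (0 : ℝ) T ×ˢ univ)) :
    ContDiffTwoFamily fun t => l (projIcc 0 T hT t) := by
  have hp : Continuous fun q : ℝ × Z => (((projIcc 0 T hT q.1 : Icc (0 : ℝ) T) : ℝ), q.2) := by
    have := continuous_projIcc (h := hT)
    fun_prop
  have hcc : ∀ k : ℕ, k ≤ 2 → Continuous fun q : ℝ × Z =>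
      iteratedFDeriv ℝ k (l (projIcc 0 T hT q.1)) q.2 := fun k hk =>
    (hc k hk).comp_continuous hp fun q => ⟨(projIcc 0 T hT q.1).2, mem_univ _⟩
  refine ⟨fun t => hl _ (projIcc 0 T hT t).2, ?_, ?_, ?_⟩
  · have h := (continuousMultilinearCurryFin0 ℝ Z W).continuous.comp (hcc 0 (by norm_num))
    refine h.congr fun q => ?_
    simp [Function.uncurry]
  · have h := (continuousMultilinearCurryFin1 ℝ Z W).continuous.comp (hcc 1 (by norm_num))
    refine h.congr fun q => ?_
    ext v
    simp [Function.uncurry, iteratedFDeriv_one_apply]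
  · have h2 := (continuousMultilinearCurryLeftEquiv ℝ (fun _ : Fin 2 => Z) W).continuous.comp
      (hcc 2 le_rfl)
    have h := ((continuousMultilinearCurryFin1 ℝ Z
      W).toContinuousLinearEquiv.toContinuousLinearMap.postcomp Z).continuous.comp h2
    refine h.congr fun q => ?_
    ext v w
    simp [Function.uncurry, iteratedFDeriv_two_apply]

end Nemytskii

/-! ### Curves as elements of `Lp`, primitives, and Volterra operators -/

section PairOp

variable {Ω : Type*} [MeasurableSpace Ω] {μ : Measure Ω}
  {E F : Type*} [NormedAddCommGroup E] [NormedSpace ℝ E] [NormedAddCommGroup F] [NormedSpace ℝ F]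

/-- The pairing `(x, u) ↦ (t ↦ (x t, u t))` of two `L^p` functions. -/
def pairOp (p : ENNReal) [Fact (1 ≤ p)] : Lp E p μ × Lp F p μ →L[ℝ] Lp (E × F) p μ :=
  (ContinuousLinearMap.inl ℝ E F).compLpL p μ ∘L ContinuousLinearMap.fst ℝ _ _ +
    (ContinuousLinearMap.inr ℝ E F).compLpL p μ ∘L ContinuousLinearMap.snd ℝ _ _

theorem coeFn_pairOp {p : ENNReal} [Fact (1 ≤ p)] (x : Lp E p μ) (u : Lp F p μ) :
    pairOp p (x, u) =ᵐ[μ] fun t => (x t, u t) := by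
  have h : pairOp p (x, u) = (ContinuousLinearMap.inl ℝ E F).compLp x +
    (ContinuousLinearMap.inr ℝ E F).compLp u := rfl
  rw [h]
  filter_upwards [Lp.coeFn_add ((ContinuousLinearMap.inl ℝ E F).compLp x)
    ((ContinuousLinearMap.inr ℝ E F).compLp u),
    (ContinuousLinearMap.inl ℝ E F).coeFn_compLp x,
    (ContinuousLinearMap.inr ℝ E F).coeFn_compLp u] with t h1 h2 h3
  rw [h1, Pi.add_apply, h2, h3]
  simp

theorem pairOp_incl₁ [IsFiniteMeasure μ] (x : Lp E ⊤ μ) (u : Lp F ⊤ μ) :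
    pairOp 1 (incl₁ x, incl₁ u) = incl₁ (pairOp ⊤ (x, u)) := by
  refine Lp.ext ?_
  filter_upwards [coeFn_pairOp (incl₁ x) (incl₁ u), coeFn_pairOp x u,
    coeFn_lpIncl le_top x (p := 1), coeFn_lpIncl le_top u (p := 1),
    coeFn_lpIncl le_top (pairOp ⊤ (x, u)) (p := 1)] with t h1 h2 h3 h4 h5
  rw [h1, h3, h4, h5, h2]

end PairOp

section TimeOperators

variable {T : ℝ} {E : Type*} [NormedAddCommGroup E] [NormedSpace ℝ E]

/-- The inclusion of the continuous functions on `[0, T]` in `L^∞`. -/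
def stateOp (hT : 0 < T) : C(Icc (0 : ℝ) T, E) →L[ℝ] Lp E ⊤ (timeMeasure T) :=
  have hbd : ∀ (x : C(Icc (0 : ℝ) T, E)) t, ‖IccExtend hT.le x t‖ ≤ ‖x‖ := fun x t =>
    x.norm_coe_le_norm _
  have hmem : ∀ x : C(Icc (0 : ℝ) T, E), MemLp (IccExtend hT.le x) ⊤ (timeMeasure T) := fun x =>
    memLp_top_of_bound (x.continuous.Icc_extend' (h := hT.le)).aestronglyMeasurable ‖x‖
      (.of_forall (hbd x))
  LinearMap.mkContinuous
    { toFun := fun x => (hmem x).toLp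
      map_add' := fun x y => by
        rw [← MemLp.toLp_add]; rfl
      map_smul' := fun c x => by
        rw [RingHom.id_apply, ← MemLp.toLp_const_smul]; rfl }
    1
    (fun x => by
      rw [one_mul]
      refine norm_le_of_ae_norm_le (norm_nonneg x) ?_
      filter_upwards [(hmem x).coeFn_toLp] with t ht
      exact (congrArg norm ht).trans_le (hbd x t))

theorem coeFn_stateOp (hT : 0 < T) (x : C(Icc (0 : ℝ) T, E)) :
    stateOp hT x =ᵐ[timeMeasure T] IccExtend hT.le x :=
  MemLp.coeFn_toLp (memLp_top_of_bound
    (x.continuous.Icc_extend' (h := hT.le)).aestronglyMeasurable ‖x‖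
    (.of_forall fun _ => x.norm_coe_le_norm _))

theorem intervalIntegrable_coeFn (z : Lp E 1 (timeMeasure T)) {t : ℝ} (ht : t ∈ Icc (0 : ℝ) T) :
    IntervalIntegrable z volume 0 t := by
  have h : IntegrableOn z (Icc 0 T) := L1.integrable_coeFn z
  refine (h.mono_set ?_).intervalIntegrable
  rw [uIcc_of_le ht.1]
  exact Icc_subset_Icc_right ht.2

theorem ae_uIoc_of_ae {P : ℝ → Prop} (h : ∀ᵐ t ∂(timeMeasure T), P t) {t : ℝ}
    (ht : t ∈ Icc (0 : ℝ) T) : ∀ᵐ s, s ∈ Ioc 0 t → P s := by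
  rw [ae_restrict_iff' measurableSet_Icc] at h
  filter_upwards [h] with s hs hst
  exact hs ⟨hst.1.le, hst.2.trans ht.2⟩

variable [CompleteSpace E]

/-- Integration from the left endpoint, as an operator from `L^1` to the continuous functions. -/
def primitiveOp (hT : 0 < T) : Lp E 1 (timeMeasure T) →L[ℝ] C(Icc (0 : ℝ) T, E) :=
  LinearMap.mkContinuous
    { toFun := fun z => ⟨fun t => ∫ s in (0 : ℝ)..t, z s, by
        have h := intervalIntegral.continuousOn_primitive_interval (a := 0) (b := T)
          (f := z) (μ := volume) (by
            rw [uIcc_of_le hT.le]; exact L1.integrable_coeFn z)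
        rw [uIcc_of_le hT.le] at h
        exact continuousOn_iff_continuous_domRestrict.1 h⟩
      map_add' := fun z w => by
        ext1 t
        show ∫ s in (0 : ℝ)..t, (z + w) s = (∫ s in (0 : ℝ)..t, z s) + ∫ s in (0 : ℝ)..t, w s
        rw [← intervalIntegral.integral_add (intervalIntegrable_coeFn z t.2)
          (intervalIntegrable_coeFn w t.2)]
        refine intervalIntegral.integral_congr_ae ?_
        rw [uIoc_of_le t.2.1]
        exact ae_uIoc_of_ae (Lp.coeFn_add z w) t.2
      map_smul' := fun c z => by
        ext1 t
        show ∫ s in (0 : ℝ)..t, (c • z) s = c • ∫ s in (0 : ℝ)..t, z s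
        rw [← intervalIntegral.integral_smul]
        refine intervalIntegral.integral_congr_ae ?_
        rw [uIoc_of_le t.2.1]
        exact ae_uIoc_of_ae (Lp.coeFn_smul c z) t.2 }
    1
    (fun z => by
      rw [one_mul, ContinuousMap.norm_le _ (norm_nonneg z)]
      intro t
      show ‖∫ s in (0 : ℝ)..t, z s‖ ≤ _
      rw [L1.norm_eq_integral_norm, intervalIntegral.integral_of_le t.2.1]
      refine (norm_integral_le_integral_norm _).trans ?_
      refine setIntegral_mono_set (L1.integrable_coeFn z).norm (.of_forall fun _ => norm_nonneg _)
        (LE.le.eventuallyLE fun s hs => ⟨hs.1.le, hs.2.trans t.2.2⟩))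

theorem primitiveOp_apply (hT : 0 < T) (z : Lp E 1 (timeMeasure T)) (t : Icc (0 : ℝ) T) :
    primitiveOp hT z t = ∫ s in (0 : ℝ)..t, z s := rfl

theorem primitiveOp_apply_of_ae_eq (hT : 0 < T) {z : Lp E 1 (timeMeasure T)} {g : ℝ → E}
    (h : z =ᵐ[timeMeasure T] g) (t : Icc (0 : ℝ) T) :
    primitiveOp hT z t = ∫ s in (0 : ℝ)..t, g s := by
  rw [primitiveOp_apply]
  refine intervalIntegral.integral_congr_ae ?_
  rw [uIoc_of_le t.2.1]
  exact ae_uIoc_of_ae h t.2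

/-- One step of Picard's iteration gains a factor `c t / (k + 1)`. -/
theorem norm_primitiveOp_le (hT : 0 < T) {z : Lp E 1 (timeMeasure T)} {y : C(Icc (0 : ℝ) T, E)}
    {c A : ℝ} {k : ℕ} (hc : 0 ≤ c)
    (hz : ∀ᵐ t ∂(timeMeasure T), ‖z t‖ ≤ c * ‖IccExtend hT.le y t‖)
    (hy : ∀ t : Icc (0 : ℝ) T, ‖y t‖ ≤ A * ((c * t) ^ k / k.factorial)) (t : Icc (0 : ℝ) T) :
    ‖primitiveOp hT z t‖ ≤ A * ((c * t) ^ (k + 1) / (k + 1).factorial) := by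
  rw [primitiveOp_apply]
  have h1 : ∀ᵐ s, s ∈ Ioc (0 : ℝ) t → ‖z s‖ ≤ c * (A * ((c * s) ^ k / k.factorial)) := by
    filter_upwards [ae_uIoc_of_ae hz t.2] with s hs hst
    have hsT : s ∈ Icc (0 : ℝ) T := ⟨hst.1.le, hst.2.trans t.2.2⟩
    refine (hs hst).trans (mul_le_mul_of_nonneg_left ?_ hc)
    rw [IccExtend_of_mem hT.le _ hsT]
    exact hy ⟨s, hsT⟩
  refine (intervalIntegral.norm_integral_le_of_norm_le t.2.1 h1
    (by apply Continuous.intervalIntegrable; fun_prop)).trans (le_of_eq ?_)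
  have h2 : ∀ s : ℝ, c * (A * ((c * s) ^ k / k.factorial))
      = (A * c ^ (k + 1) / k.factorial) * s ^ k := fun s => by
    rw [mul_pow, pow_succ]; ring
  simp_rw [h2]
  rw [intervalIntegral.integral_const_mul, integral_pow, Nat.factorial_succ, mul_pow]
  have : (k.factorial : ℝ) ≠ 0 := by positivity
  have : (k : ℝ) + 1 ≠ 0 := by positivity
  push_cast
  rw [zero_pow (Nat.succ_ne_zero k), sub_zero]
  field_simp

/-- Gronwall's uniqueness argument: a continuous function which is the primitive of a function that
it bounds is zero. -/
theorem eq_zero_of_eq_primitiveOp (hT : 0 < T) {z : Lp E 1 (timeMeasure T)}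
    {y : C(Icc (0 : ℝ) T, E)} {c : ℝ} (hc : 0 ≤ c)
    (hz : ∀ᵐ t ∂(timeMeasure T), ‖z t‖ ≤ c * ‖IccExtend hT.le y t‖)
    (hy : y = primitiveOp hT z) : y = 0 := by
  have h : ∀ (k : ℕ) (t : Icc (0 : ℝ) T), ‖y t‖ ≤ ‖y‖ * ((c * t) ^ k / k.factorial) := by
    intro k
    induction k with
    | zero => intro t; simpa using y.norm_coe_le_norm t
    | succ k ih =>
      intro t
      conv_lhs => rw [hy]
      exact norm_primitiveOp_le hT hc hz ih t
  ext1 t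
  rw [ContinuousMap.zero_apply, ← norm_le_zero_iff]
  have hlim := (FloorSemiring.tendsto_pow_div_factorial_atTop (c * (t : ℝ))).const_mul ‖y‖
  rw [mul_zero] at hlim
  exact ge_of_tendsto' hlim fun k => h k t

/-- Volterra operators are quasinilpotent: if `b` is bounded pointwise, then `1 - ∫ b` is invertible,
because the norm of the `k`-th power of `∫ b` is at most `(c T) ^ k / k!`. -/
theorem isUnit_one_sub_primitiveOp_comp (hT : 0 < T)
    (b : C(Icc (0 : ℝ) T, E) →L[ℝ] Lp E 1 (timeMeasure T)) {c : ℝ} (hc : 0 ≤ c)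
    (hb : ∀ y, ∀ᵐ t ∂(timeMeasure T), ‖b y t‖ ≤ c * ‖IccExtend hT.le y t‖) :
    IsUnit (1 - primitiveOp hT ∘L b) := by
  set Q : C(Icc (0 : ℝ) T, E) →L[ℝ] C(Icc (0 : ℝ) T, E) := primitiveOp hT ∘L b with hQ
  have h : ∀ (k : ℕ) (y : C(Icc (0 : ℝ) T, E)) (t : Icc (0 : ℝ) T),
      ‖(Q ^ k) y t‖ ≤ ‖y‖ * ((c * t) ^ k / k.factorial) := by
    intro k
    induction k with
    | zero => intro y t; simpa using y.norm_coe_le_norm t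
    | succ k ih =>
      intro y t
      have e : (Q ^ (k + 1)) y = primitiveOp hT (b ((Q ^ k) y)) := by rw [pow_succ']; rfl
      rw [e]
      exact norm_primitiveOp_le hT hc (hb _) (ih y) t
  have hn : ∀ k : ℕ, ‖Q ^ k‖ ≤ (c * T) ^ k / k.factorial := fun k => by
    refine ContinuousLinearMap.opNorm_le_bound _ (by positivity) fun y => ?_
    rw [ContinuousMap.norm_le _ (by positivity)]
    intro t
    refine (h k y t).trans ?_
    rw [mul_comm]
    have h0 : 0 ≤ c * (t : ℝ) := mul_nonneg hc t.2.1
    have : c * (t : ℝ) ≤ c * T := mul_le_mul_of_nonneg_left t.2.2 hc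
    gcongr
  obtain ⟨k, hk⟩ := ((FloorSemiring.tendsto_pow_div_factorial_atTop (c * T)).eventually
    (gt_mem_nhds one_pos)).exists
  have hu : IsUnit (1 - Q ^ k) := isUnit_one_sub_of_norm_lt_one ((hn k).trans_lt hk)
  -- `1 - Q` is a factor of `1 - Q ^ k`, which is invertible by the Neumann series
  have hcomm : Commute (∑ i ∈ Finset.range k, Q ^ i) (1 - Q) :=
    ((Commute.one_right _).sub_right
      (Commute.sum_left _ _ _ fun i _ => (Commute.refl Q).pow_left i))
  rw [← geom_sum_mul_neg, hcomm.isUnit_mul_iff] at hu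
  exact hu.2

end TimeOperators

/-! ### The feedback system as an equation between Banach spaces -/

section System

variable {n m : ℕ} {T : ℝ}

/-- The Banach space of states. -/
abbrev StateSpace (n : ℕ) (T : ℝ) := C(Icc (0 : ℝ) T, Vec n)

/-- The Banach space of inputs. -/
abbrev InputSpace (m : ℕ) (T : ℝ) := Lp (Vec m) ⊤ (timeMeasure T)

/-- The integrable inputs, to which the derivatives extend. -/
abbrev InputSpace₁ (m : ℕ) (T : ℝ) := Lp (Vec m) 1 (timeMeasure T)

/-- The gains, as elements of `L^∞`. -/
abbrev GainSpace (n m : ℕ) (T : ℝ) := Lp (Vec n →L[ℝ] Vec m) ⊤ (timeMeasure T)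

variable (hT : 0 < T) (κ : GainSpace n m T)

/-- The feedback `x ↦ K x`. -/
def feedbackOp : StateSpace n T →L[ℝ] InputSpace m T := mulOp ⊤ κ ∘L stateOp hT

theorem coeFn_feedbackOp (x : StateSpace n T) :
    feedbackOp hT κ x =ᵐ[timeMeasure T] fun t => κ t (IccExtend hT.le x t) := by
  filter_upwards [coeFn_mulOp κ (stateOp hT x), coeFn_stateOp hT x] with t h1 h2
  rw [← h2, ← h1]
  rfl

/-- The feedforward `(α, μ) ↦ μ + K α`: the part of the input of the feedback system that does not
depend on its state. -/
def feedforward : Curve n m T →L[ℝ] InputSpace m T :=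
  ContinuousLinearMap.snd ℝ (StateSpace n T) (InputSpace m T) +
    feedbackOp hT κ ∘L ContinuousLinearMap.fst ℝ (StateSpace n T) (InputSpace m T)

theorem feedforward_apply (ξ : Curve n m T) : feedforward hT κ ξ = ξ.2 + feedbackOp hT κ ξ.1 := rfl

/-- The curve `(x, v - K x)` with feedforward `v` and state `x`. -/
def curveOp : InputSpace m T × StateSpace n T →L[ℝ] Curve n m T :=
  (ContinuousLinearMap.snd ℝ _ _).prod
    (ContinuousLinearMap.fst ℝ _ _ - feedbackOp hT κ ∘L ContinuousLinearMap.snd ℝ _ _)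

theorem curveOp_apply (v : InputSpace m T) (x : StateSpace n T) :
    curveOp hT κ (v, x) = (x, v - feedbackOp hT κ x) := rfl

theorem feedforward_curveOp (q : InputSpace m T × StateSpace n T) :
    feedforward hT κ (curveOp hT κ q) = q.1 := by
  rw [feedforward_apply, curveOp_apply]; simp

theorem curveOp_feedforward (ξ : Curve n m T) :
    curveOp hT κ (feedforward hT κ ξ, ξ.1) = ξ := by
  rw [feedforward_apply, curveOp_apply]; simp

/-- The pointwise values `(x t, v t - K t x t)` of state and input. -/
def stateInput : InputSpace m T × StateSpace n T →L[ℝ] Lp (Vec n × Vec m) ⊤ (timeMeasure T) :=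
  pairOp ⊤ ∘L (stateOp hT ∘L ContinuousLinearMap.snd ℝ _ _).prod
    (ContinuousLinearMap.fst ℝ _ _ - feedbackOp hT κ ∘L ContinuousLinearMap.snd ℝ _ _)

/-- The extension of `stateInput` to integrable feedforwards. -/
def stateInput₁ : InputSpace₁ m T × StateSpace n T →L[ℝ] Lp (Vec n × Vec m) 1 (timeMeasure T) :=
  pairOp 1 ∘L (incl₁ ∘L stateOp hT ∘L ContinuousLinearMap.snd ℝ _ _).prod
    (ContinuousLinearMap.fst ℝ _ _ - incl₁ ∘L feedbackOp hT κ ∘L ContinuousLinearMap.snd ℝ _ _)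

theorem coeFn_stateInput (v : InputSpace m T) (x : StateSpace n T) :
    stateInput hT κ (v, x) =ᵐ[timeMeasure T]
      fun t => (IccExtend hT.le x t, v t - κ t (IccExtend hT.le x t)) := by
  have h : stateInput hT κ (v, x) = pairOp ⊤ (stateOp hT x, v - feedbackOp hT κ x) := rfl
  rw [h]
  filter_upwards [coeFn_pairOp (stateOp hT x) (v - feedbackOp hT κ x), coeFn_stateOp hT x,
    Lp.coeFn_sub v (feedbackOp hT κ x), coeFn_feedbackOp hT κ x] with t h1 h2 h3 h4
  rw [h1, h2, h3, Pi.sub_apply, h4]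

theorem stateInput₁_incl₁ (v : InputSpace m T) (x : StateSpace n T) :
    stateInput₁ hT κ (incl₁ v, x) = incl₁ (stateInput hT κ (v, x)) := by
  have h : stateInput hT κ (v, x) = pairOp ⊤ (stateOp hT x, v - feedbackOp hT κ x) := rfl
  have h' : stateInput₁ hT κ (incl₁ v, x)
    = pairOp 1 (incl₁ (stateOp hT x), incl₁ v - incl₁ (feedbackOp hT κ x)) := rfl
  rw [h, h', ← map_sub, pairOp_incl₁]

/-- The pointwise values of state and input are Lipschitz in the state. -/
theorem norm_stateInput_sub_le (v : InputSpace m T) (x x' : StateSpace n T) :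
    ∀ᵐ t ∂(timeMeasure T), ‖stateInput hT κ (v, x) t - stateInput hT κ (v, x') t‖
      ≤ (1 + ‖κ‖) * ‖IccExtend hT.le (x - x') t‖ := by
  filter_upwards [coeFn_stateInput hT κ v x, coeFn_stateInput hT κ v x', ae_norm_le_norm κ]
    with t h1 h2 h3
  have e : IccExtend hT.le (x - x') t = IccExtend hT.le x t - IccExtend hT.le x' t := rfl
  rw [h1, h2, e]
  set a := IccExtend hT.le x t
  set b := IccExtend hT.le x' t
  have h4 : ‖κ t (a - b)‖ ≤ ‖κ‖ * ‖a - b‖ := (κ t).le_of_opNorm_le h3 _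
  have h5 : (a, v t - κ t a) - (b, v t - κ t b) = (a - b, -(κ t (a - b))) := by
    rw [Prod.mk_sub_mk, map_sub]; congr 1; abel
  rw [h5, Prod.norm_def, norm_neg]
  refine max_le ?_ ?_
  · nlinarith [norm_nonneg κ, norm_nonneg (a - b)]
  · nlinarith [norm_nonneg κ, norm_nonneg (a - b)]

variable {f : Vec n × Vec m → Vec n} (hf : ContDiffTwoFamily fun _ : ℝ => f) (x₀ : Vec n)

/-- The map whose zeros `(v, x)` are the solutions of the feedback system with feedforward `v`. -/
def dynMap (q : InputSpace m T × StateSpace n T) : StateSpace n T :=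
  q.2 - ContinuousMap.const _ x₀
    - primitiveOp hT (incl₁ (nemytskii hf.cont (stateInput hT κ q)))

/-- The derivative of `dynMap`, extended to integrable feedforwards. -/
def dynDeriv (q : InputSpace m T × StateSpace n T) :
    InputSpace₁ m T × StateSpace n T →L[ℝ] StateSpace n T :=
  ContinuousLinearMap.snd ℝ _ _ -
    primitiveOp hT ∘L mulOp 1 (nemytskii hf.cont_fderiv (stateInput hT κ q)) ∘L stateInput₁ hT κ

/-- The inclusion of the bounded feedforwards in the integrable ones, with the state kept. -/
def inclState : InputSpace m T × StateSpace n T →L[ℝ] InputSpace₁ m T × StateSpace n T :=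
  (incl₁ : InputSpace m T →L[ℝ] InputSpace₁ m T).prodMap (ContinuousLinearMap.id ℝ (StateSpace n T))

theorem contDiff_dynMap : ContDiff ℝ 2 (dynMap hT κ hf x₀) := by
  have h1 := hf.contDiff_nemytskii (T := T)
  have h2 : ContDiff ℝ 2 fun q : InputSpace m T × StateSpace n T =>
      primitiveOp hT (incl₁ (nemytskii hf.cont (stateInput hT κ q))) :=
    ((h1.comp (stateInput hT κ).contDiff).continuousLinearMap_comp
      (primitiveOp (E := Vec n) hT ∘L incl₁))
  exact (contDiff_snd.sub contDiff_const).sub h2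

theorem contDiff_dynDeriv : ContDiff ℝ 1 (dynDeriv (n := n) hT κ hf) := by
  have h1 := hf.contDiff_nemytskii_fderiv (T := T)
  have h2 : ContDiff ℝ 1 fun q : InputSpace m T × StateSpace n T =>
      mulOp 1 (nemytskii hf.cont_fderiv (stateInput hT κ q)) :=
    (h1.comp (stateInput hT κ).contDiff).continuousLinearMap_comp
      (mulOp (μ := timeMeasure T) (Z := Vec n × Vec m) (W := Vec n) 1)
  exact contDiff_const.sub (contDiff_const.clm_comp (h2.clm_comp contDiff_const))

theorem hasFDerivAt_dynMap (q : InputSpace m T × StateSpace n T) :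
    HasFDerivAt (dynMap hT κ hf x₀) (dynDeriv hT κ hf q ∘L inclState) q := by
  have h1 := (hf.hasFDerivAt_nemytskii (T := T) (stateInput hT κ q)).comp q
    (stateInput hT κ).hasFDerivAt
  have h2 := (primitiveOp (E := Vec n) hT).hasFDerivAt.comp q
    ((incl₁ (E := Vec n) (μ := timeMeasure T)).hasFDerivAt.comp q h1)
  have h3 := ((hasFDerivAt_snd (𝕜 := ℝ) (p := q)).sub_const (ContinuousMap.const _ x₀)).sub h2
  refine h3.congr_fderiv ?_
  refine ContinuousLinearMap.ext fun ⟨w, y⟩ => ?_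
  show y - primitiveOp hT (incl₁ (mulOp ⊤ (nemytskii hf.cont_fderiv (stateInput hT κ q))
      (stateInput hT κ (w, y)))) = y - primitiveOp hT (mulOp 1
        (nemytskii hf.cont_fderiv (stateInput hT κ q)) (stateInput₁ hT κ (incl₁ w, y)))
  rw [stateInput₁_incl₁, mulOp_incl₁]

/-- The derivative of `dynMap` with respect to the state is a Volterra operator of the second
kind. -/
theorem isUnit_dynDeriv_comp_inr (q : InputSpace m T × StateSpace n T) :
    IsUnit (dynDeriv hT κ hf q ∘L ContinuousLinearMap.inr ℝ (InputSpace₁ m T) (StateSpace n T)) := by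
  set a := nemytskii hf.cont_fderiv (stateInput hT κ q) with ha
  set b : StateSpace n T →L[ℝ] Lp (Vec n) 1 (timeMeasure T) :=
    mulOp 1 a ∘L stateInput₁ hT κ ∘L ContinuousLinearMap.inr ℝ _ _ with hb
  have e : dynDeriv hT κ hf q ∘L ContinuousLinearMap.inr ℝ (InputSpace₁ m T) (StateSpace n T)
      = 1 - primitiveOp hT ∘L b := by
    ext1 y; rfl
  rw [e]
  refine isUnit_one_sub_primitiveOp_comp hT b (c := ‖a‖ * (1 + ‖κ‖)) (by positivity) fun y => ?_
  have h0 : b y = mulOp 1 a (incl₁ (stateInput hT κ (0, y))) := by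
    rw [← stateInput₁_incl₁, map_zero]; rfl
  rw [h0]
  filter_upwards [coeFn_mulOp a (incl₁ (stateInput hT κ (0, y))),
    coeFn_lpIncl le_top (stateInput hT κ (0, y)) (p := 1), ae_norm_le_norm a,
    norm_stateInput_sub_le hT κ 0 y 0, Lp.coeFn_zero (Vec n × Vec m) ⊤ (timeMeasure T)]
    with t h1 h2 h3 h4 h5
  have h6 : stateInput hT κ (0, (0 : StateSpace n T)) = 0 := map_zero (stateInput hT κ)
  rw [h6, h5, Pi.zero_apply, sub_zero, sub_zero] at h4
  rw [h1, h2, mul_assoc]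
  exact ((a t).le_of_opNorm_le h3 _).trans (by gcongr)

theorem isInvertible_dynDeriv_comp_inr (q : InputSpace m T × StateSpace n T) :
    (dynDeriv hT κ hf q ∘L
      ContinuousLinearMap.inr ℝ (InputSpace₁ m T) (StateSpace n T)).IsInvertible := by
  obtain ⟨u, hu⟩ := isUnit_dynDeriv_comp_inr hT κ hf q
  exact ⟨ContinuousLinearEquiv.unitsEquiv ℝ (StateSpace n T) u, by rw [← hu]; rfl⟩

/-- Uniqueness of the response: `f` is Lipschitz on bounded sets. -/
theorem eq_of_dynMap_eq_zero {v : InputSpace m T} {x x' : StateSpace n T}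
    (hx : dynMap hT κ hf x₀ (v, x) = 0) (hx' : dynMap hT κ hf x₀ (v, x') = 0) : x = x' := by
  set q := stateInput hT κ (v, x) with hq
  set q' := stateInput hT κ (v, x') with hq'
  set R := max ‖q‖ ‖q'‖ with hR
  obtain ⟨C, hC⟩ := (isCompact_closedBall (0 : Vec n × Vec m) R).exists_bound_of_continuousOn
    ((hf.contDiff 0).continuous_fderiv (by norm_num)).continuousOn
  have hlip : ∀ a b : Vec n × Vec m, ‖a‖ ≤ R → ‖b‖ ≤ R → ‖f a - f b‖ ≤ |C| * ‖a - b‖ :=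
    fun a b ha hb => (convex_closedBall (0 : Vec n × Vec m) R).norm_image_sub_le_of_norm_fderiv_le
      (fun y _ => (hf.contDiff 0).differentiable (by norm_num) y)
      (fun y hy => (hC y hy).trans (le_abs_self C)) (by simpa using hb) (by simpa using ha)
  have key : x - x' = primitiveOp hT (incl₁ (nemytskii hf.cont q - nemytskii hf.cont q')) := by
    rw [map_sub, map_sub]
    have e1 : x - ContinuousMap.const _ x₀ - primitiveOp hT (incl₁ (nemytskii hf.cont q)) = 0 := hx
    have e2 : x' - ContinuousMap.const _ x₀ - primitiveOp hT (incl₁ (nemytskii hf.cont q')) = 0 :=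
      hx'
    rw [← sub_eq_zero.1 e1, ← sub_eq_zero.1 e2]
    abel
  refine sub_eq_zero.1 (eq_zero_of_eq_primitiveOp hT (c := |C| * (1 + ‖κ‖)) (by positivity) ?_ key)
  filter_upwards [coeFn_lpIncl le_top (nemytskii hf.cont q - nemytskii hf.cont q') (p := 1),
    Lp.coeFn_sub (nemytskii hf.cont q) (nemytskii hf.cont q'), coeFn_nemytskii hf.cont q,
    coeFn_nemytskii hf.cont q', norm_stateInput_sub_le hT κ v x x', ae_norm_le_norm q,
    ae_norm_le_norm q'] with t h1 h2 h3 h4 h5 h6 h7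
  rw [h1, h2, Pi.sub_apply, h3, h4, mul_assoc]
  exact (hlip _ _ (h6.trans (le_max_left _ _)) (h7.trans (le_max_right _ _))).trans (by gcongr)

variable {K : ℝ → Vec n →L[ℝ] Vec m}

/-- A curve is a trajectory if and only if its state solves the feedback system with its own
feedforward. -/
theorem mem_trajectories_iff (η : Curve n m T) :
    η ∈ trajectories hT f x₀ ↔ dynMap hT κ hf x₀ (feedforward hT κ η, η.1) = 0 := by
  have hq : stateInput hT κ (feedforward hT κ η, η.1) = pairOp ⊤ (stateOp hT η.1, η.2) := by
    have h : stateInput hT κ (feedforward hT κ η, η.1)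
      = pairOp ⊤ (stateOp hT η.1, feedforward hT κ η - feedbackOp hT κ η.1) := rfl
    rw [h, feedforward_apply, add_sub_cancel_right]
  have hae : (incl₁ (nemytskii hf.cont (stateInput hT κ (feedforward hT κ η, η.1))) :
      Lp (Vec n) 1 (timeMeasure T)) =ᵐ[timeMeasure T]
      fun s => f (Curve.state hT η s, Curve.input η s) := by
    rw [hq]
    filter_upwards [coeFn_lpIncl le_top (nemytskii hf.cont (pairOp ⊤ (stateOp hT η.1, η.2))) (p := 1),
      coeFn_nemytskii hf.cont (pairOp ⊤ (stateOp hT η.1, η.2)), coeFn_pairOp (stateOp hT η.1) η.2,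
      coeFn_stateOp hT η.1] with t h1 h2 h3 h4
    rw [h1, h2, h3, h4]
    rfl
  have hval : ∀ t : Icc (0 : ℝ) T, dynMap hT κ hf x₀ (feedforward hT κ η, η.1) t
      = η.1 t - x₀ - ∫ s in (0 : ℝ)..t, f (Curve.state hT η s, Curve.input η s) := fun t => by
    rw [← primitiveOp_apply_of_ae_eq hT hae t]
    rfl
  have hst : ∀ (t : ℝ) (ht : t ∈ Icc (0 : ℝ) T), Curve.state hT η t = η.1 ⟨t, ht⟩ := fun t ht =>
    IccExtend_of_mem hT.le _ ht
  constructor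
  · intro h
    ext1 t
    rw [hval, ContinuousMap.zero_apply, sub_sub, sub_eq_zero, ← h t t.2, hst]
  · intro h t ht
    have := hval ⟨t, ht⟩
    rw [h, ContinuousMap.zero_apply, sub_sub] at this
    rw [hst t ht, ← sub_eq_zero, ← this]

theorem isFeedbackResponse_iff (hκ : κ =ᵐ[timeMeasure T] K) (ξ η : Curve n m T) :
    IsFeedbackResponse hT f x₀ K ξ η ↔
      dynMap hT κ hf x₀ (feedforward hT κ ξ, η.1) = 0 ∧
        η = curveOp hT κ (feedforward hT κ ξ, η.1) := by
  have h1 : (∀ᵐ t ∂(volume.restrict (Icc (0 : ℝ) T)),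
      Curve.input η t = Curve.input ξ t + K t (Curve.state hT ξ t - Curve.state hT η t)) ↔
      feedforward hT κ η = feedforward hT κ ξ := by
    rw [feedforward_apply, feedforward_apply, Lp.ext_iff]
    have h2 : ∀ᵐ t ∂(timeMeasure T),
        ((η.2 + feedbackOp hT κ η.1 : InputSpace m T) t = η.2 t + K t (Curve.state hT η t)) ∧
        ((ξ.2 + feedbackOp hT κ ξ.1 : InputSpace m T) t = ξ.2 t + K t (Curve.state hT ξ t)) := by
      filter_upwards [Lp.coeFn_add η.2 (feedbackOp hT κ η.1), coeFn_feedbackOp hT κ η.1,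
        Lp.coeFn_add ξ.2 (feedbackOp hT κ ξ.1), coeFn_feedbackOp hT κ ξ.1, hκ]
        with t a1 a2 a3 a4 a5
      rw [a1, a3, Pi.add_apply, Pi.add_apply, a2, a4, a5]
      exact ⟨rfl, rfl⟩
    refine Filter.eventually_congr ?_
    filter_upwards [h2] with t ht
    rw [ht.1, ht.2, map_sub]
    show η.2 t = ξ.2 t + _ ↔ _
    constructor
    · intro h; rw [h]; abel
    · intro h; rw [← sub_eq_zero] at h ⊢; rw [← h]; abel
  rw [IsFeedbackResponse, h1, mem_trajectories_iff hT κ hf]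
  constructor
  · rintro ⟨h2, h3⟩
    rw [← h3]
    exact ⟨h2, (curveOp_feedforward hT κ η).symm⟩
  · rintro ⟨h2, h3⟩
    have h4 : feedforward hT κ η = feedforward hT κ ξ := by
      rw [h3, feedforward_curveOp]
    rw [h4]
    exact ⟨h2, rfl⟩

end System

/-! ### The solution operator and the projection operator -/

section Solution

variable {n m : ℕ} {T : ℝ} (hT : 0 < T) (κ : GainSpace n m T)
  {f : Vec n × Vec m → Vec n} (hf : ContDiffTwoFamily fun _ : ℝ => f) (x₀ : Vec n)
  {K : ℝ → Vec n →L[ℝ] Vec m}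

/-- The feedforwards for which the feedback system has a solution on all of `[0, T]`. -/
def solvable : Set (InputSpace m T) := {v | ∃ x, dynMap hT κ hf x₀ (v, x) = 0}

open Classical in
/-- The state of the feedback system with a given feedforward (with the value `0` where there is no
solution). -/
def solution (v : InputSpace m T) : StateSpace n T :=
  if h : v ∈ solvable hT κ hf x₀ then h.choose else 0

theorem dynMap_solution {v : InputSpace m T} (hv : v ∈ solvable hT κ hf x₀) :
    dynMap hT κ hf x₀ (v, solution hT κ hf x₀ v) = 0 := by
  rw [solution, dif_pos hv]
  exact hv.choose_spec

theorem solution_eq {v : InputSpace m T} {x : StateSpace n T}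
    (hx : dynMap hT κ hf x₀ (v, x) = 0) : solution hT κ hf x₀ v = x :=
  eq_of_dynMap_eq_zero hT κ hf x₀ (dynMap_solution hT κ hf x₀ ⟨x, hx⟩) hx

/-- The derivative of the state with respect to the feedforward, extended to integrable
feedforwards. -/
def solutionDeriv (v : InputSpace m T) : InputSpace₁ m T →L[ℝ] StateSpace n T :=
  -(dynDeriv hT κ hf (v, solution hT κ hf x₀ v) ∘L ContinuousLinearMap.inr ℝ _ _).inverse ∘L
    (dynDeriv hT κ hf (v, solution hT κ hf x₀ v) ∘L ContinuousLinearMap.inl ℝ _ _)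

/-- The feedback system keeps a solution under small changes of the feedforward, and its state is a
`C^2` function of the feedforward: this is the implicit function theorem for `dynMap`. -/
theorem solution_of_mem_solvable {v : InputSpace m T} (hv : v ∈ solvable hT κ hf x₀) :
    solvable hT κ hf x₀ ∈ 𝓝 v ∧ ContDiffAt ℝ 2 (solution hT κ hf x₀) v ∧
      HasFDerivAt (solution hT κ hf x₀) (solutionDeriv hT κ hf x₀ v ∘L incl₁) v := by
  set u : InputSpace m T × StateSpace n T := (v, solution hT κ hf x₀ v) with hu
  have hzero : dynMap hT κ hf x₀ u = 0 := dynMap_solution hT κ hf x₀ hv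
  have hcd : ContDiffAt ℝ 2 (dynMap hT κ hf x₀) u := (contDiff_dynMap hT κ hf x₀).contDiffAt
  have hder : fderiv ℝ (dynMap hT κ hf x₀) u = dynDeriv hT κ hf u ∘L inclState :=
    (hasFDerivAt_dynMap hT κ hf x₀ u).fderiv
  have hr : fderiv ℝ (dynMap hT κ hf x₀) u ∘L
      ContinuousLinearMap.inr ℝ (InputSpace m T) (StateSpace n T) =
      dynDeriv hT κ hf u ∘L ContinuousLinearMap.inr ℝ (InputSpace₁ m T) (StateSpace n T) := by
    rw [hder]
    ext1 y
    show dynDeriv hT κ hf u (incl₁ 0, y) = dynDeriv hT κ hf u (0, y)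
    rw [map_zero]
  have hl : fderiv ℝ (dynMap hT κ hf x₀) u ∘L
      ContinuousLinearMap.inl ℝ (InputSpace m T) (StateSpace n T) =
      (dynDeriv hT κ hf u ∘L ContinuousLinearMap.inl ℝ (InputSpace₁ m T) (StateSpace n T)) ∘L
        incl₁ := by
    rw [hder]
    rfl
  have hinv : (fderiv ℝ (dynMap hT κ hf x₀) u ∘L
      ContinuousLinearMap.inr ℝ (InputSpace m T) (StateSpace n T)).IsInvertible := by
    rw [hr]
    exact isInvertible_dynDeriv_comp_inr hT κ hf u
  have hev := hcd.eventually_apply_implicitFunction two_ne_zero hinv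
  rw [hzero] at hev
  have heq : solution hT κ hf x₀ =ᶠ[𝓝 v] hcd.implicitFunction two_ne_zero hinv := by
    filter_upwards [hev] with w hw
    exact solution_eq hT κ hf x₀ hw
  refine ⟨?_, ?_, ?_⟩
  · filter_upwards [hev] with w hw
    exact ⟨_, hw⟩
  · exact (hcd.contDiffAt_implicitFunction two_ne_zero hinv).congr_of_eventuallyEq heq
  · have h := (hcd.hasStrictFDerivAt_implicitFunction two_ne_zero hinv).hasFDerivAt
    rw [hr, hl] at h
    exact h.congr_of_eventuallyEq heq

theorem contDiffAt_solutionDeriv {v : InputSpace m T} (hv : v ∈ solvable hT κ hf x₀) :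
    ContDiffAt ℝ 1 (solutionDeriv hT κ hf x₀) v := by
  have h1 : ContDiffAt ℝ 1 (fun v => (v, solution hT κ hf x₀ v)) v :=
    contDiffAt_id.prodMk ((solution_of_mem_solvable hT κ hf x₀ hv).2.1.of_le (by norm_num))
  have h2 : ContDiffAt ℝ 1 (fun v => dynDeriv hT κ hf (v, solution hT κ hf x₀ v)) v :=
    (contDiff_dynDeriv hT κ hf).contDiffAt.comp v h1
  have h3 : ContDiffAt ℝ 1 (fun v => dynDeriv hT κ hf (v, solution hT κ hf x₀ v) ∘L
      ContinuousLinearMap.inr ℝ (InputSpace₁ m T) (StateSpace n T)) v :=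
    h2.clm_comp contDiffAt_const
  have h4 : ContDiffAt ℝ 1 (fun v => dynDeriv hT κ hf (v, solution hT κ hf x₀ v) ∘L
      ContinuousLinearMap.inl ℝ (InputSpace₁ m T) (StateSpace n T)) v :=
    h2.clm_comp contDiffAt_const
  have h5 := ((isInvertible_dynDeriv_comp_inr hT κ hf
    (v, solution hT κ hf x₀ v)).contDiffAt_map_inverse (n := 1)).comp v h3
  exact h5.neg.clm_comp h4

/-- The curve of the feedback system with a given feedforward. -/
def response (v : InputSpace m T) : Curve n m T := curveOp hT κ (v, solution hT κ hf x₀ v)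

theorem feedforward_response (v : InputSpace m T) :
    feedforward hT κ (response hT κ hf x₀ v) = v := feedforward_curveOp hT κ _

theorem contDiffAt_response {v : InputSpace m T} (hv : v ∈ solvable hT κ hf x₀) :
    ContDiffAt ℝ 2 (response hT κ hf x₀) v :=
  (contDiffAt_id.prodMk (solution_of_mem_solvable hT κ hf x₀ hv).2.1).continuousLinearMap_comp
    (curveOp hT κ)

theorem hasFDerivAt_response {v : InputSpace m T} (hv : v ∈ solvable hT κ hf x₀) :
    HasFDerivAt (response hT κ hf x₀)
      (curveOp hT κ ∘L (ContinuousLinearMap.id ℝ (InputSpace m T)).prod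
        (solutionDeriv hT κ hf x₀ v ∘L incl₁)) v :=
  (curveOp hT κ).hasFDerivAt.comp v
    ((hasFDerivAt_id v).prodMk (solution_of_mem_solvable hT κ hf x₀ hv).2.2)

theorem response_mem_trajectories {v : InputSpace m T} (hv : v ∈ solvable hT κ hf x₀) :
    response hT κ hf x₀ v ∈ trajectories hT f x₀ := by
  rw [mem_trajectories_iff hT κ hf, feedforward_response]
  exact dynMap_solution hT κ hf x₀ hv

theorem feedforward_mem_solvable {η : Curve n m T} (hη : η ∈ trajectories hT f x₀) :
    feedforward hT κ η ∈ solvable hT κ hf x₀ :=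
  ⟨η.1, (mem_trajectories_iff hT κ hf x₀ η).1 hη⟩

theorem response_feedforward {η : Curve n m T} (hη : η ∈ trajectories hT f x₀) :
    response hT κ hf x₀ (feedforward hT κ η) = η := by
  rw [response, solution_eq hT κ hf x₀ ((mem_trajectories_iff hT κ hf x₀ η).1 hη),
    curveOp_feedforward]

theorem mem_projectionDom (hκ : κ =ᵐ[timeMeasure T] K) {ξ : Curve n m T}
    (hξ : feedforward hT κ ξ ∈ solvable hT κ hf x₀) : ξ ∈ projectionDom hT f x₀ K :=
  ⟨response hT κ hf x₀ (feedforward hT κ ξ), (isFeedbackResponse_iff hT κ hf x₀ hκ _ _).2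
    ⟨dynMap_solution hT κ hf x₀ hξ, rfl⟩⟩

/-- The projection of a curve depends on its feedforward only. -/
theorem projection_eq_response (hκ : κ =ᵐ[timeMeasure T] K) {ξ : Curve n m T}
    (hξ : feedforward hT κ ξ ∈ solvable hT κ hf x₀) :
    projection hT f x₀ K ξ = response hT κ hf x₀ (feedforward hT κ ξ) := by
  have h : ∃ η, IsFeedbackResponse hT f x₀ K ξ η := mem_projectionDom hT κ hf x₀ hκ hξ
  rw [projection, dif_pos h]
  obtain ⟨h1, h2⟩ := (isFeedbackResponse_iff hT κ hf x₀ hκ _ _).1 h.choose_spec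
  rw [h2, response, solution_eq hT κ hf x₀ h1]

theorem eventually_feedforward_mem_solvable {ξ : Curve n m T}
    (hξ : feedforward hT κ ξ ∈ solvable hT κ hf x₀) :
    ∀ᶠ ζ in 𝓝 ξ, feedforward hT κ ζ ∈ solvable hT κ hf x₀ :=
  (feedforward hT κ).continuous.continuousAt.eventually
    (solution_of_mem_solvable hT κ hf x₀ hξ).1

theorem projection_eventuallyEq (hκ : κ =ᵐ[timeMeasure T] K) {ξ : Curve n m T}
    (hξ : feedforward hT κ ξ ∈ solvable hT κ hf x₀) :
    projection hT f x₀ K =ᶠ[𝓝 ξ] fun ζ => response hT κ hf x₀ (feedforward hT κ ζ) := by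
  filter_upwards [eventually_feedforward_mem_solvable hT κ hf x₀ hξ] with ζ hζ
  exact projection_eq_response hT κ hf x₀ hκ hζ

theorem contDiffAt_projection (hκ : κ =ᵐ[timeMeasure T] K) {ξ : Curve n m T}
    (hξ : feedforward hT κ ξ ∈ solvable hT κ hf x₀) :
    ContDiffAt ℝ 2 (projection hT f x₀ K) ξ :=
  ((contDiffAt_response hT κ hf x₀ hξ).comp ξ
    (feedforward hT κ).contDiff.contDiffAt).congr_of_eventuallyEq
      (projection_eventuallyEq hT κ hf x₀ hκ hξ)

/-- The tangent vectors at a curve are the first-order responses to the variations of its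
feedforward. -/
theorem mem_tangentSpace_iff (hκ : κ =ᵐ[timeMeasure T] K) {ξ : Curve n m T}
    (hξ : feedforward hT κ ξ ∈ solvable hT κ hf x₀) (ζ : Curve n m T) :
    ζ ∈ tangentSpace hT f x₀ K ξ ↔
      curveOp hT κ (feedforward hT κ ζ, solutionDeriv hT κ hf x₀ (feedforward hT κ ξ)
        (incl₁ (feedforward hT κ ζ))) = ζ := by
  have h : HasFDerivAt (projection hT f x₀ K) _ ξ :=
    ((hasFDerivAt_response hT κ hf x₀ hξ).comp ξ
      (feedforward hT κ).hasFDerivAt).congr_of_eventuallyEq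
        (projection_eventuallyEq hT κ hf x₀ hκ hξ)
  rw [tangentSpace, mem_ofPred_eq, h.fderiv]
  rfl

end Solution

/-! ### The cost in terms of the feedforward, and its gradient -/

section ProdMap

variable {A U X : Type*} [NormedAddCommGroup A] [NormedSpace ℝ A] [NormedAddCommGroup U]
  [NormedSpace ℝ U] [NormedAddCommGroup X] [NormedSpace ℝ X]

theorem contDiffAt_id_prod {k : WithTop ℕ∞} {σ : A → U →L[ℝ] X} {a : A}
    (hσ : ContDiffAt ℝ k σ a) :
    ContDiffAt ℝ k (fun r => (ContinuousLinearMap.id ℝ U).prod (σ r)) a := by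
  have e : ∀ r, (ContinuousLinearMap.id ℝ U).prod (σ r) = ContinuousLinearMap.inl ℝ U X +
      ContinuousLinearMap.inr ℝ U X ∘L σ r := fun r => by
    refine ContinuousLinearMap.ext fun w => ?_
    simp
  simp_rw [e]
  exact contDiffAt_const.add (contDiffAt_const.clm_comp hσ)

theorem contDiffAt_comp_graph {P V : Type*} [NormedAddCommGroup P] [NormedSpace ℝ P]
    [NormedAddCommGroup V] [NormedSpace ℝ V] {c : P → A × X → (U × X →L[ℝ] V)} {σ : A → X}
    {σ' : A → U →L[ℝ] X} {k : WithTop ℕ∞} {a : A} (ρ : P)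
    (hc : ContDiff ℝ k fun r : P × A × X => c r.1 r.2) (hσ : ContDiffAt ℝ k σ a)
    (hσ' : ContDiffAt ℝ k σ' a) :
    ContDiffAt ℝ k (fun r : P × A => c r.1 (r.2, σ r.2) ∘L
      (ContinuousLinearMap.id ℝ U).prod (σ' r.2)) (ρ, a) := by
  have h1 : ContDiffAt ℝ k (fun r : P × A => σ r.2) (ρ, a) := hσ.comp (ρ, a) contDiffAt_snd
  have h2 : ContDiffAt ℝ k (fun r : P × A => c r.1 (r.2, σ r.2)) (ρ, a) :=
    hc.contDiffAt.comp (ρ, a) (contDiffAt_fst.prodMk (contDiffAt_snd.prodMk h1))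
  exact h2.clm_comp (contDiffAt_id_prod (hσ'.comp (ρ, a) contDiffAt_snd))

end ProdMap

section Cost

variable {n m p : ℕ} {T : ℝ} (hT : 0 < T) (κ : GainSpace n m T)

/-- The inclusion `(x, u) ↦ (x, u, 0)`. -/
def inclPoint (n m p : ℕ) : Vec n × Vec m →L[ℝ] Vec n × Vec m × Vec p :=
  (ContinuousLinearMap.fst ℝ _ _).prod ((ContinuousLinearMap.snd ℝ _ _).prod 0)

/-- The inclusion `ρ ↦ (0, 0, ρ)`. -/
def inclParam (n m p : ℕ) : Vec p →L[ℝ] Vec n × Vec m × Vec p :=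
  (0 : Vec p →L[ℝ] Vec n).prod ((0 : Vec p →L[ℝ] Vec m).prod (ContinuousLinearMap.id ℝ _))

/-- The constant functions `(0, 0, ρ)` of time. -/
def paramOp (n m p : ℕ) (T : ℝ) : Vec p →L[ℝ] Lp (Vec n × Vec m × Vec p) ⊤ (timeMeasure T) :=
  Lp.constL ⊤ (timeMeasure T) ℝ ∘L inclParam n m p

/-- The pointwise values `(x t, v t - K t x t, 0)`. -/
def costArg (p : ℕ) : InputSpace m T × StateSpace n T →L[ℝ]
    Lp (Vec n × Vec m × Vec p) ⊤ (timeMeasure T) :=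
  (inclPoint n m p).compLpL ⊤ (timeMeasure T) ∘L stateInput hT κ

/-- The extension of `costArg` to integrable feedforwards. -/
def costArg₁ (p : ℕ) : InputSpace₁ m T × StateSpace n T →L[ℝ]
    Lp (Vec n × Vec m × Vec p) 1 (timeMeasure T) :=
  (inclPoint n m p).compLpL 1 (timeMeasure T) ∘L stateInput₁ hT κ

theorem coeFn_costArg (q : InputSpace m T × StateSpace n T) :
    costArg hT κ p q =ᵐ[timeMeasure T] fun t => inclPoint n m p (stateInput hT κ q t) :=
  (inclPoint n m p).coeFn_compLp (stateInput hT κ q)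

theorem costArg₁_incl₁ (v : InputSpace m T) (x : StateSpace n T) :
    costArg₁ hT κ p (incl₁ v, x) = incl₁ (costArg hT κ p (v, x)) := by
  have h : costArg₁ hT κ p (incl₁ v, x) = (inclPoint n m p).compLp
    (stateInput₁ hT κ (incl₁ v, x)) := rfl
  rw [h, stateInput₁_incl₁]
  refine Lp.ext ?_
  filter_upwards [coeFn_costArg (p := p) hT κ (v, x),
    coeFn_lpIncl le_top (costArg hT κ p (v, x)) (p := 1),
    coeFn_lpIncl le_top (stateInput hT κ (v, x)) (p := 1),
    (inclPoint n m p).coeFn_compLp (incl₁ (stateInput hT κ (v, x)))] with t h1 h2 h3 h4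
  rw [h4, h3, h2, h1]

theorem coeFn_costArg_add_paramOp (v : InputSpace m T) (x : StateSpace n T) (ρ : Vec p) :
    costArg hT κ p (v, x) + paramOp n m p T ρ =ᵐ[timeMeasure T] fun t =>
      (Curve.state hT (curveOp hT κ (v, x)) t, Curve.input (curveOp hT κ (v, x)) t, ρ) := by
  have hc : paramOp n m p T ρ = Lp.const ⊤ (timeMeasure T) (inclParam n m p ρ) := rfl
  rw [hc]
  filter_upwards [Lp.coeFn_add (costArg hT κ p (v, x))
    (Lp.const ⊤ (timeMeasure T) (inclParam n m p ρ)), coeFn_costArg (p := p) hT κ (v, x),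
    Lp.coeFn_const ⊤ (timeMeasure T) (inclParam n m p ρ), coeFn_stateInput hT κ v x,
    Lp.coeFn_sub v (feedbackOp hT κ x), coeFn_feedbackOp hT κ x] with t h1 h2 h3 h4 h5 h6
  have e : Curve.input (curveOp hT κ (v, x)) t = v t - κ t (IccExtend hT.le x t) := by
    rw [← h6, ← Pi.sub_apply, ← h5]; rfl
  rw [h1, Pi.add_apply, h2, h3, h4, e]
  simp [inclPoint, inclParam, Curve.state, curveOp_apply]

/-- The value of the state at the final time. -/
def finalOp (n : ℕ) (hT : 0 < T) : StateSpace n T →L[ℝ] Vec n :=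
  ContinuousMap.evalCLM ℝ (⟨T, right_mem_Icc.2 hT.le⟩ : Icc (0 : ℝ) T)

variable {l : ℝ → Vec n × Vec m × Vec p → ℝ} (hl : ContDiffTwoFamily l)
  (φ : Vec n × Vec p → ℝ)

/-- The cost of the curve with given feedforward and state. -/
def costMap (ρ : Vec p) (q : InputSpace m T × StateSpace n T) : ℝ :=
  L1.integralCLM (incl₁ (nemytskii hl.cont (costArg hT κ p q + paramOp n m p T ρ)))
    + φ (finalOp n hT q.2, ρ)

/-- The derivative of `costMap` in feedforward and state, extended to integrable feedforwards. -/
def costDeriv (ρ : Vec p) (q : InputSpace m T × StateSpace n T) :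
    InputSpace₁ m T × StateSpace n T →L[ℝ] ℝ :=
  L1.integralCLM ∘L mulOp 1 (nemytskii hl.cont_fderiv (costArg hT κ p q + paramOp n m p T ρ)) ∘L
      costArg₁ hT κ p +
    fderiv ℝ φ (finalOp n hT q.2, ρ) ∘L ContinuousLinearMap.inl ℝ (Vec n) (Vec p) ∘L
      finalOp n hT ∘L ContinuousLinearMap.snd ℝ _ _

theorem contDiff_costMap (hφ : ContDiff ℝ 2 φ) (ρ : Vec p) :
    ContDiff ℝ 2 (costMap hT κ hl φ ρ) := by
  have h1 : ContDiff ℝ 2 fun q : InputSpace m T × StateSpace n T =>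
      costArg hT κ p q + paramOp n m p T ρ :=
    (costArg hT κ p).contDiff.add contDiff_const
  have h2 : ContDiff ℝ 2 fun q : InputSpace m T × StateSpace n T => (finalOp n hT q.2, ρ) :=
    ((finalOp n hT ∘L ContinuousLinearMap.snd ℝ (InputSpace m T) (StateSpace n T)).contDiff).prodMk
      contDiff_const
  exact (((hl.contDiff_nemytskii (T := T)).comp h1).continuousLinearMap_comp
    ((L1.integralCLM : Lp ℝ 1 (timeMeasure T) →L[ℝ] ℝ) ∘L incl₁)).add (hφ.comp h2)

theorem contDiff_costDeriv (hφ : ContDiff ℝ 2 φ) :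
    ContDiff ℝ 1 fun r : Vec p × InputSpace m T × StateSpace n T =>
      costDeriv hT κ hl φ r.1 r.2 := by
  have h1 : ContDiff ℝ 1 fun r : Vec p × InputSpace m T × StateSpace n T =>
      costArg hT κ p r.2 + paramOp n m p T r.1 :=
    ((costArg hT κ p).contDiff.comp contDiff_snd).add
      ((paramOp n m p T).contDiff.comp contDiff_fst)
  have h2 : ContDiff ℝ 1 fun r : Vec p × InputSpace m T × StateSpace n T =>
      (finalOp n hT r.2.2, r.1) :=
    ((finalOp n hT ∘L ContinuousLinearMap.snd ℝ (InputSpace m T) (StateSpace n T) ∘L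
      ContinuousLinearMap.snd ℝ (Vec p) (InputSpace m T × StateSpace n T)).contDiff).prodMk
      contDiff_fst
  have h3 : ContDiff ℝ 1 fun r : Vec p × InputSpace m T × StateSpace n T =>
      mulOp 1 (nemytskii hl.cont_fderiv (costArg hT κ p r.2 + paramOp n m p T r.1)) :=
    ((hl.contDiff_nemytskii_fderiv (T := T)).comp h1).continuousLinearMap_comp
      (mulOp (μ := timeMeasure T) (Z := Vec n × Vec m × Vec p) (W := ℝ) 1)
  have h4 : ContDiff ℝ 1 fun r : Vec p × InputSpace m T × StateSpace n T =>
      fderiv ℝ φ (finalOp n hT r.2.2, r.1) :=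
    (hφ.fderiv_right (m := 1) (by norm_num)).comp h2
  exact (contDiff_const.clm_comp (h3.clm_comp contDiff_const)).add (h4.clm_comp contDiff_const)

theorem hasFDerivAt_costMap (hφ : ContDiff ℝ 2 φ) (ρ : Vec p)
    (q : InputSpace m T × StateSpace n T) :
    HasFDerivAt (costMap hT κ hl φ ρ) (costDeriv hT κ hl φ ρ q ∘L inclState) q := by
  have h1 := (hl.hasFDerivAt_nemytskii (T := T) (costArg hT κ p q + paramOp n m p T ρ)).comp q
    ((costArg hT κ p).hasFDerivAt.add_const (paramOp n m p T ρ))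
  have h2 := ((L1.integralCLM : Lp ℝ 1 (timeMeasure T) →L[ℝ] ℝ) ∘L incl₁).hasFDerivAt.comp q h1
  have h3 := ((finalOp n hT ∘L ContinuousLinearMap.snd ℝ (InputSpace m T)
    (StateSpace n T)).hasFDerivAt (x := q)).prodMk (hasFDerivAt_const ρ q)
  have h4 := ((hφ.differentiable (by norm_num) (finalOp n hT q.2, ρ)).hasFDerivAt).comp q h3
  refine (h2.add h4).congr_fderiv ?_
  refine ContinuousLinearMap.ext fun ⟨w, y⟩ => ?_
  set a := nemytskii hl.cont_fderiv (costArg hT κ p q + paramOp n m p T ρ)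
  show L1.integralCLM (incl₁ (mulOp ⊤ a (costArg hT κ p (w, y)))) +
      fderiv ℝ φ (finalOp n hT q.2, ρ) (finalOp n hT y, 0) =
    L1.integralCLM (mulOp 1 a (costArg₁ hT κ p (incl₁ w, y))) +
      fderiv ℝ φ (finalOp n hT q.2, ρ) (finalOp n hT y, 0)
  rw [costArg₁_incl₁, mulOp_incl₁]

/-- `costMap` is the cost of the curve, for any running cost that agrees with `l` on `[0, T]`. -/
theorem cost_curveOp {l' : ℝ → Vec n × Vec m × Vec p → ℝ} (hl' : ∀ t ∈ Icc (0 : ℝ) T, l' t = l t)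
    (ρ : Vec p) (q : InputSpace m T × StateSpace n T) :
    cost hT l' φ (curveOp hT κ q) ρ = costMap hT κ hl φ ρ q := by
  obtain ⟨v, x⟩ := q
  have h1 : Curve.state hT (curveOp hT κ (v, x)) T = finalOp n hT x :=
    IccExtend_of_mem hT.le _ (right_mem_Icc.2 hT.le)
  rw [cost, costMap, h1]
  congr 1
  rw [← L1.integral_eq, L1.integral_eq_integral, intervalIntegral.integral_of_le hT.le,
    ← integral_Icc_eq_integral_Ioc]
  refine integral_congr_ae ?_
  filter_upwards [ae_mem_Icc T, coeFn_costArg_add_paramOp hT κ v x ρ,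
    coeFn_nemytskii hl.cont (costArg hT κ p (v, x) + paramOp n m p T ρ),
    coeFn_lpIncl le_top (nemytskii hl.cont (costArg hT κ p (v, x) + paramOp n m p T ρ)) (p := 1)]
    with t h1 h2 h3 h4
  rw [h4, h3, h2, hl' t h1]

variable {f : Vec n × Vec m → Vec n} (hf : ContDiffTwoFamily fun _ : ℝ => f) (x₀ : Vec n)

/-- The cost as a function of the feedforward. -/
def inputCost (ρ : Vec p) (v : InputSpace m T) : ℝ :=
  costMap hT κ hl φ ρ (v, solution hT κ hf x₀ v)

/-- The derivative of `inputCost`, extended to integrable feedforwards. -/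
def gradient (ρ : Vec p) (v : InputSpace m T) : InputSpace₁ m T →L[ℝ] ℝ :=
  costDeriv hT κ hl φ ρ (v, solution hT κ hf x₀ v) ∘L
    (ContinuousLinearMap.id ℝ (InputSpace₁ m T)).prod (solutionDeriv hT κ hf x₀ v)

theorem hasFDerivAt_inputCost (hφ : ContDiff ℝ 2 φ) (ρ : Vec p) {v : InputSpace m T}
    (hv : v ∈ solvable hT κ hf x₀) :
    HasFDerivAt (inputCost hT κ hl φ hf x₀ ρ) (gradient hT κ hl φ hf x₀ ρ v ∘L incl₁) v := by
  have h1 := hasFDerivAt_costMap hT κ hl φ hφ ρ (v, solution hT κ hf x₀ v)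
  have h2 := (hasFDerivAt_id v).prodMk (solution_of_mem_solvable hT κ hf x₀ hv).2.2
  exact (h1.comp v h2 :)

theorem contDiffAt_inputCost (hφ : ContDiff ℝ 2 φ) (ρ : Vec p) {v : InputSpace m T}
    (hv : v ∈ solvable hT κ hf x₀) : ContDiffAt ℝ 2 (inputCost hT κ hl φ hf x₀ ρ) v :=
  (contDiff_costMap hT κ hl φ hφ ρ).contDiffAt.comp v
    (contDiffAt_id.prodMk (solution_of_mem_solvable hT κ hf x₀ hv).2.1)

theorem contDiffAt_gradient (hφ : ContDiff ℝ 2 φ) (ρ : Vec p) {v : InputSpace m T}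
    (hv : v ∈ solvable hT κ hf x₀) :
    ContDiffAt ℝ 1 (fun r : Vec p × InputSpace m T => gradient hT κ hl φ hf x₀ r.1 r.2) (ρ, v) := by
  exact contDiffAt_comp_graph ρ (contDiff_costDeriv hT κ hl φ hφ)
    ((solution_of_mem_solvable hT κ hf x₀ hv).2.1.of_le (by norm_num))
    (contDiffAt_solutionDeriv hT κ hf x₀ hv)

theorem reducedCost_eq_inputCost {K : ℝ → Vec n →L[ℝ] Vec m} (hκ : κ =ᵐ[timeMeasure T] K)
    {l' : ℝ → Vec n × Vec m × Vec p → ℝ} (hl' : ∀ t ∈ Icc (0 : ℝ) T, l' t = l t) (ρ : Vec p)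
    {ξ : Curve n m T} (hξ : feedforward hT κ ξ ∈ solvable hT κ hf x₀) :
    reducedCost hT f x₀ K l' φ ρ ξ = inputCost hT κ hl φ hf x₀ ρ (feedforward hT κ ξ) := by
  rw [reducedCost, projection_eq_response hT κ hf x₀ hκ hξ, response,
    cost_curveOp hT κ hl φ hl', inputCost]

end Cost

/-! ### The Hessian on pairs of inputs with disjoint supports -/

section SecondDerivatives

variable {A X Y V D : Type*} [NormedAddCommGroup A] [NormedSpace ℝ A]
  [NormedAddCommGroup X] [NormedSpace ℝ X] [NormedAddCommGroup Y] [NormedSpace ℝ Y]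
  [NormedAddCommGroup V] [NormedSpace ℝ V] [NormedAddCommGroup D] [NormedSpace ℝ D]

/-- The second derivative of `a ↦ L (a, σ a)` does not involve the second derivative of `σ` at a
point where the partial derivative of `L` in the second variable vanishes. -/
theorem fderiv_fderiv_comp_graph {L : A × X → ℝ} {σ : A → X} {σ' : A →L[ℝ] X} {a : A}
    (hL : ContDiff ℝ 2 L) (hσ : ContDiffAt ℝ 2 σ a) (hσ' : HasFDerivAt σ σ' a)
    (hcrit : fderiv ℝ L (a, σ a) ∘L ContinuousLinearMap.inr ℝ A X = 0) (w z : A) :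
    fderiv ℝ (fderiv ℝ fun a => L (a, σ a)) a w z
      = fderiv ℝ (fderiv ℝ L) (a, σ a) (w, σ' w) (z, σ' z) := by
  have hL1 : ContDiff ℝ 1 (fderiv ℝ L) := hL.fderiv_right (by norm_num)
  have hev : ∀ᶠ b in 𝓝 a, fderiv ℝ (fun a => L (a, σ a)) b
      = fderiv ℝ L (b, σ b) ∘L (ContinuousLinearMap.inl ℝ A X +
        ContinuousLinearMap.inr ℝ A X ∘L fderiv ℝ σ b) := by
    filter_upwards [hσ.eventually (by simp)] with b hb
    have h1 := (hL.differentiable (by norm_num) (b, σ b)).hasFDerivAt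
    have h2 := (hasFDerivAt_id b).prodMk (hb.differentiableAt (by norm_num)).hasFDerivAt
    refine (h1.comp b h2).fderiv.trans ?_
    refine ContinuousLinearMap.ext fun w => ?_
    simp [← map_add]
  have hσ2 : DifferentiableAt ℝ (fderiv ℝ σ) a :=
    (hσ.fderiv_right (m := 1) (by norm_num)).differentiableAt (by norm_num)
  have hd : HasFDerivAt (fun b => ContinuousLinearMap.inl ℝ A X +
      ContinuousLinearMap.inr ℝ A X ∘L fderiv ℝ σ b)
      ((ContinuousLinearMap.compL ℝ A X (A × X) (ContinuousLinearMap.inr ℝ A X)) ∘L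
        fderiv ℝ (fderiv ℝ σ) a) a :=
    (((ContinuousLinearMap.compL ℝ A X (A × X)
      (ContinuousLinearMap.inr ℝ A X)).hasFDerivAt).comp a hσ2.hasFDerivAt).const_add _
  have hc : HasFDerivAt (fun b => fderiv ℝ L (b, σ b))
      (fderiv ℝ (fderiv ℝ L) (a, σ a) ∘L (ContinuousLinearMap.id ℝ A).prod σ') a :=
    (hL1.differentiable (by norm_num) (a, σ a)).hasFDerivAt.comp a ((hasFDerivAt_id a).prodMk hσ')
  have h := hc.clm_comp hd
  rw [Filter.EventuallyEq.fderiv_eq hev, h.fderiv]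
  have e : fderiv ℝ L (a, σ a) (0, fderiv ℝ (fderiv ℝ σ) a w z) = 0 := by
    have := congrArg (fun g => g (fderiv ℝ (fderiv ℝ σ) a w z)) hcrit
    simpa using this
  simp [hσ'.fderiv, e, ← map_add]

/-- The second derivative of a functional of `N ∘ Q`, with `Q` affine. -/
theorem fderiv_fderiv_comp_affine {N : Y → V} {N' : Y → D} {M : D →L[ℝ] (Y →L[ℝ] V)}
    (hN : ∀ y, HasFDerivAt N (M (N' y)) y) (Q : A →L[ℝ] Y) (y₀ : Y) (ℓ : V →L[ℝ] ℝ) {a : A}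
    {N'' : Y →L[ℝ] D} (hN' : HasFDerivAt N' N'' (Q a + y₀)) (w z : A) :
    fderiv ℝ (fderiv ℝ fun a => ℓ (N (Q a + y₀))) a w z = ℓ (M (N'' (Q w)) (Q z)) := by
  have hQ : ∀ a, HasFDerivAt (fun a => Q a + y₀) Q a := fun a => Q.hasFDerivAt.add_const y₀
  have h1 : (fderiv ℝ fun a => ℓ (N (Q a + y₀))) = fun a => (ℓ ∘L M (N' (Q a + y₀))) ∘L Q := by
    ext1 a
    exact (ℓ.hasFDerivAt.comp a ((hN _).comp a (hQ a))).fderiv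
  have h2 : HasFDerivAt (fun a => (ℓ ∘L M (N' (Q a + y₀))) ∘L Q) _ a :=
    ((hasFDerivAt_const ℓ a).clm_comp ((M.hasFDerivAt.comp a (hN'.comp a (hQ a))))).clm_comp
      (hasFDerivAt_const Q a)
  rw [h1, h2.fderiv]
  simp

theorem fderiv_fderiv_add {F G : A → ℝ} (hF : ContDiff ℝ 2 F) (hG : ContDiff ℝ 2 G) (a w z : A) :
    fderiv ℝ (fderiv ℝ fun a => F a + G a) a w z
      = fderiv ℝ (fderiv ℝ F) a w z + fderiv ℝ (fderiv ℝ G) a w z := by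
  have h1 : (fderiv ℝ fun a => F a + G a) = fun a => fderiv ℝ F a + fderiv ℝ G a := by
    ext1 a
    exact fderiv_fun_add (hF.differentiable (by norm_num) a) (hG.differentiable (by norm_num) a)
  have h2 : DifferentiableAt ℝ (fderiv ℝ F) a :=
    (hF.fderiv_right (m := 1) (by norm_num)).differentiable (by norm_num) a
  have h3 : DifferentiableAt ℝ (fderiv ℝ G) a :=
    (hG.fderiv_right (m := 1) (by norm_num)).differentiable (by norm_num) a
  rw [h1, fderiv_fun_add h2 h3]
  rfl

theorem fderiv_fderiv_comp_snd {ψ : X → ℝ} (hψ : ContDiff ℝ 2 ψ) (a w z : A × X) :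
    fderiv ℝ (fderiv ℝ fun q : A × X => ψ q.2) a w z = fderiv ℝ (fderiv ℝ ψ) a.2 w.2 z.2 := by
  have h := fderiv_fderiv_comp_affine (M := ContinuousLinearMap.id ℝ (X →L[ℝ] ℝ))
    (fun y => (hψ.differentiable (by norm_num) y).hasFDerivAt) (ContinuousLinearMap.snd ℝ A X) 0
    (ContinuousLinearMap.id ℝ ℝ) (a := a)
    (((hψ.fderiv_right (m := 1) (by norm_num)).differentiable (by norm_num) _).hasFDerivAt) w z
  simpa using h

theorem fderiv_fderiv_of_fderiv_eventuallyEq {F : A → ℝ} {g : A → (V →L[ℝ] ℝ)} {i : A →L[ℝ] V}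
    {a : A} (h : ∀ᶠ b in 𝓝 a, fderiv ℝ F b = g b ∘L i) (hg : DifferentiableAt ℝ g a) (w z : A) :
    fderiv ℝ (fderiv ℝ F) a w z = fderiv ℝ g a w (i z) := by
  rw [Filter.EventuallyEq.fderiv_eq h,
    (hg.hasFDerivAt.clm_comp (hasFDerivAt_const i a)).fderiv]
  simp

theorem hasFDerivAt_partial_snd {P Y : Type*} [NormedAddCommGroup P]
    [NormedSpace ℝ P] [NormedAddCommGroup Y] [NormedSpace ℝ Y] {g : P → A → Y} {ρ : P} {a : A}
    (h : ContDiffAt ℝ 1 (fun r : P × A => g r.1 r.2) (ρ, a)) :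
    HasFDerivAt (g ρ) (fderiv ℝ (fun r : P × A => g r.1 r.2) (ρ, a) ∘L
      ContinuousLinearMap.inr ℝ P A) a := by
  have h1 : HasFDerivAt (fun b : A => (ρ, b)) (ContinuousLinearMap.inr ℝ P A) a :=
    (hasFDerivAt_const ρ a).prodMk (hasFDerivAt_id a)
  exact (h.differentiableAt (by norm_num)).hasFDerivAt.comp a h1

end SecondDerivatives

section Hessian

variable {n m p : ℕ} {T : ℝ} (hT : 0 < T) (κ : GainSpace n m T)

/-- The second derivative at `q` of a functional of feedforward and state is bounded by the integral
of the product of the pointwise norms of its arguments. -/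
def HasIntegralHessianBound (Ψ : InputSpace m T × StateSpace n T → ℝ)
    (q : InputSpace m T × StateSpace n T) : Prop :=
  ∃ C : ℝ, 0 ≤ C ∧ ∀ (a b : InputSpace m T × StateSpace n T) (g : ℝ → ℝ),
    Integrable g (timeMeasure T) →
    (∀ᵐ t ∂(timeMeasure T), (‖a.1 t‖ + ‖a.2‖) * (‖b.1 t‖ + ‖b.2‖) ≤ g t) →
    |fderiv ℝ (fderiv ℝ Ψ) q a b| ≤ C * ∫ t, g t ∂(timeMeasure T)

theorem HasIntegralHessianBound.add {F G : InputSpace m T × StateSpace n T → ℝ}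
    {q : InputSpace m T × StateSpace n T} (hF : ContDiff ℝ 2 F) (hG : ContDiff ℝ 2 G)
    (h1 : HasIntegralHessianBound F q) (h2 : HasIntegralHessianBound G q) :
    HasIntegralHessianBound (fun q => F q + G q) q := by
  obtain ⟨C, hC, h1⟩ := h1
  obtain ⟨C', hC', h2⟩ := h2
  refine ⟨C + C', by positivity, fun a b g hg hab => ?_⟩
  rw [fderiv_fderiv_add hF hG, add_mul]
  exact (abs_add_le _ _).trans (add_le_add (h1 a b g hg hab) (h2 a b g hg hab))

/-- A functional of the state alone satisfies the bound with the uniform norms of the states, which are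
constant in time. -/
theorem hasIntegralHessianBound_comp_snd (hT : 0 < T) {ψ : StateSpace n T → ℝ}
    (hψ : ContDiff ℝ 2 ψ) (q : InputSpace m T × StateSpace n T) :
    HasIntegralHessianBound (fun q => ψ q.2) q := by
  refine ⟨‖fderiv ℝ (fderiv ℝ ψ) q.2‖ / T, by positivity, fun a b g hg hab => ?_⟩
  rw [fderiv_fderiv_comp_snd hψ]
  have h1 : T * (‖a.2‖ * ‖b.2‖) ≤ ∫ t, g t ∂(timeMeasure T) := by
    have h2 : ∫ _, ‖a.2‖ * ‖b.2‖ ∂(timeMeasure T) = T * (‖a.2‖ * ‖b.2‖) := by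
      simp [hT.le]
    rw [← h2]
    refine integral_mono_ae (integrable_const _) hg ?_
    filter_upwards [hab] with t ht
    refine le_trans ?_ ht
    gcongr
    · linarith [norm_nonneg (a.1 t)]
    · linarith [norm_nonneg (b.1 t)]
  calc |fderiv ℝ (fderiv ℝ ψ) q.2 a.2 b.2|
      = ‖fderiv ℝ (fderiv ℝ ψ) q.2 a.2 b.2‖ := (Real.norm_eq_abs _).symm
    _ ≤ ‖fderiv ℝ (fderiv ℝ ψ) q.2‖ * ‖a.2‖ * ‖b.2‖ :=
      ContinuousLinearMap.le_opNorm₂ _ _ _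
    _ = ‖fderiv ℝ (fderiv ℝ ψ) q.2‖ / T * (T * (‖a.2‖ * ‖b.2‖)) := by field_simp
    _ ≤ _ := by gcongr

/-- The second derivative of an integral functional of a superposition operator is the integral of the
pointwise second derivative, hence local in time. -/
theorem hasIntegralHessianBound_nemytskii {Z W : Type*} [NormedAddCommGroup Z] [NormedSpace ℝ Z]
    [ProperSpace Z] [NormedAddCommGroup W] [NormedSpace ℝ W] {φ : ℝ → Z → W}
    (hφ : ContDiffTwoFamily φ) (ℓ : Lp W 1 (timeMeasure T) →L[ℝ] ℝ)
    (Q : InputSpace m T × StateSpace n T →L[ℝ] Lp Z ⊤ (timeMeasure T)) {c : ℝ} (hc : 0 ≤ c)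
    (hQ : ∀ a, ∀ᵐ t ∂(timeMeasure T), ‖Q a t‖ ≤ c * (‖a.1 t‖ + ‖a.2‖))
    (z₀ : Lp Z ⊤ (timeMeasure T)) (q : InputSpace m T × StateSpace n T) :
    HasIntegralHessianBound (fun q => ℓ (incl₁ (nemytskii hφ.cont (Q q + z₀)))) q := by
  set N := nemytskii hφ.cont_fderiv_fderiv (Q q + z₀) with hN
  refine ⟨‖ℓ‖ * (‖N‖ * c ^ 2), by positivity, fun a b g hg hab => ?_⟩
  have h : fderiv ℝ (fderiv ℝ fun q => ℓ (incl₁ (nemytskii hφ.cont (Q q + z₀)))) q a b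
      = ℓ (incl₁ (mulOp ⊤ (mulOp ⊤ N (Q a)) (Q b))) :=
    fderiv_fderiv_comp_affine (A := InputSpace m T × StateSpace n T)
      (Y := Lp Z ⊤ (timeMeasure T)) (V := Lp W ⊤ (timeMeasure T))
      (D := Lp (Z →L[ℝ] W) ⊤ (timeMeasure T)) hφ.hasFDerivAt_nemytskii Q z₀ (ℓ ∘L incl₁)
      (hφ.hasFDerivAt_nemytskii_fderiv (Q q + z₀)) a b
  rw [h, mul_assoc]
  refine (ℓ.le_opNorm _).trans ?_
  gcongr
  rw [norm_incl₁, ← integral_const_mul]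
  refine integral_mono_ae (integrable_norm _) (hg.const_mul _) ?_
  filter_upwards [hab, hQ a, hQ b, coeFn_mulOp (mulOp ⊤ N (Q a)) (Q b), coeFn_mulOp N (Q a),
    ae_norm_le_norm N] with t h1 h2 h3 h4 h5 h6
  show ‖(mulOp ⊤ (mulOp ⊤ N (Q a)) (Q b) : Lp W ⊤ (timeMeasure T)) t‖ ≤ ‖N‖ * c ^ 2 * g t
  rw [h4, h5]
  calc ‖N t (Q a t) (Q b t)‖ ≤ ‖N t‖ * ‖Q a t‖ * ‖Q b t‖ := ContinuousLinearMap.le_opNorm₂ _ _ _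
    _ ≤ ‖N‖ * (c * (‖a.1 t‖ + ‖a.2‖)) * (c * (‖b.1 t‖ + ‖b.2‖)) := by gcongr
    _ = ‖N‖ * c ^ 2 * ((‖a.1 t‖ + ‖a.2‖) * (‖b.1 t‖ + ‖b.2‖)) := by ring
    _ ≤ _ := by gcongr

theorem norm_stateInput_le (a : InputSpace m T × StateSpace n T) :
    ∀ᵐ t ∂(timeMeasure T), ‖stateInput hT κ a t‖ ≤ (1 + ‖κ‖) * (‖a.1 t‖ + ‖a.2‖) := by
  filter_upwards [coeFn_stateInput hT κ a.1 a.2, ae_norm_le_norm κ] with t h1 h2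
  have h3 : ‖IccExtend hT.le a.2 t‖ ≤ ‖a.2‖ := a.2.norm_coe_le_norm _
  have h4 : ‖κ t (IccExtend hT.le a.2 t)‖ ≤ ‖κ‖ * ‖a.2‖ :=
    ((κ t).le_of_opNorm_le h2 _).trans (by gcongr)
  have h0 := norm_nonneg (a.1 t)
  have h5 := norm_nonneg κ
  have h6 := norm_nonneg a.2
  rw [show a = (a.1, a.2) from rfl, h1, Prod.norm_def]
  refine max_le ?_ ((norm_sub_le _ _).trans ?_)
  · show ‖IccExtend hT.le a.2 t‖ ≤ _
    nlinarith
  · show ‖a.1 t‖ + ‖κ t (IccExtend hT.le a.2 t)‖ ≤ _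
    nlinarith

theorem norm_inclPoint_le (a : Vec n × Vec m) : ‖inclPoint n m p a‖ ≤ ‖a‖ := by
  simp [inclPoint, Prod.norm_def]

theorem norm_costArg_le (a : InputSpace m T × StateSpace n T) :
    ∀ᵐ t ∂(timeMeasure T), ‖costArg hT κ p a t‖ ≤ (1 + ‖κ‖) * (‖a.1 t‖ + ‖a.2‖) := by
  filter_upwards [coeFn_costArg (p := p) hT κ a, norm_stateInput_le hT κ a] with t h1 h2
  rw [h1]
  exact (norm_inclPoint_le _).trans h2

variable {l : ℝ → Vec n × Vec m × Vec p → ℝ} (hl : ContDiffTwoFamily l)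
  (φ : Vec n × Vec p → ℝ)
  {f : Vec n × Vec m → Vec n} (hf : ContDiffTwoFamily fun _ : ℝ => f) (x₀ : Vec n)

/-- The Lagrangian: the cost minus a multiplier applied to the state equation. -/
def lagrangian (ρ : Vec p) (Λ : StateSpace n T →L[ℝ] ℝ) (q : InputSpace m T × StateSpace n T) :
    ℝ :=
  costMap hT κ hl φ ρ q - Λ (dynMap hT κ hf x₀ q)

theorem contDiff_lagrangian (hφ : ContDiff ℝ 2 φ) (ρ : Vec p) (Λ : StateSpace n T →L[ℝ] ℝ) :
    ContDiff ℝ 2 (lagrangian hT κ hl φ hf x₀ ρ Λ) :=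
  (contDiff_costMap hT κ hl φ hφ ρ).sub
    ((contDiff_dynMap hT κ hf x₀).continuousLinearMap_comp Λ)

theorem hasIntegralHessianBound_lagrangian (hφ : ContDiff ℝ 2 φ) (ρ : Vec p)
    (Λ : StateSpace n T →L[ℝ] ℝ) (q : InputSpace m T × StateSpace n T) :
    HasIntegralHessianBound (lagrangian hT κ hl φ hf x₀ ρ Λ) q := by
  set F₁ : InputSpace m T × StateSpace n T → ℝ := fun q =>
    L1.integralCLM (incl₁ (nemytskii hl.cont (costArg hT κ p q + paramOp n m p T ρ))) with hF₁
  set F₂ : InputSpace m T × StateSpace n T → ℝ := fun q =>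
    (Λ ∘L primitiveOp hT) (incl₁ (nemytskii hf.cont (stateInput hT κ q + 0))) with hF₂
  set ψ : StateSpace n T → ℝ := fun x =>
    φ (finalOp n hT x, ρ) - Λ (x - ContinuousMap.const _ x₀) with hψdef
  have hF₁c : ContDiff ℝ 2 F₁ :=
    ((hl.contDiff_nemytskii (T := T)).comp ((costArg hT κ p).contDiff.add
      contDiff_const)).continuousLinearMap_comp
        ((L1.integralCLM : Lp ℝ 1 (timeMeasure T) →L[ℝ] ℝ) ∘L incl₁)
  have hF₂c : ContDiff ℝ 2 F₂ :=
    ((hf.contDiff_nemytskii (T := T)).comp ((stateInput hT κ).contDiff.add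
      contDiff_const)).continuousLinearMap_comp ((Λ ∘L primitiveOp hT) ∘L incl₁)
  have hψ : ContDiff ℝ 2 ψ :=
    (hφ.comp ((finalOp n hT).contDiff.prodMk contDiff_const)).sub
      ((contDiff_id.sub contDiff_const).continuousLinearMap_comp Λ)
  have hψc : ContDiff ℝ 2 fun q : InputSpace m T × StateSpace n T => ψ q.2 := hψ.comp contDiff_snd
  have e : lagrangian hT κ hl φ hf x₀ ρ Λ = fun q => (F₁ q + F₂ q) + ψ q.2 := by
    ext q
    simp only [lagrangian, costMap, dynMap, hF₁, hF₂, hψdef, map_sub, add_zero,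
      ContinuousLinearMap.comp_apply]
    ring
  rw [e]
  refine HasIntegralHessianBound.add (hF₁c.add hF₂c) hψc
    (HasIntegralHessianBound.add hF₁c hF₂c ?_ ?_) (hasIntegralHessianBound_comp_snd hT hψ q)
  · exact hasIntegralHessianBound_nemytskii hl _ (costArg hT κ p) (by positivity)
      (norm_costArg_le hT κ) _ q
  · exact hasIntegralHessianBound_nemytskii hf _ (stateInput hT κ) (by positivity)
      (norm_stateInput_le hT κ) _ q

/-- Near a solvable feedforward the second derivative of the cost is represented by the derivative
of the gradient. -/
theorem fderiv_fderiv_inputCost (hφ : ContDiff ℝ 2 φ) (ρ : Vec p) {v : InputSpace m T}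
    (hv : v ∈ solvable hT κ hf x₀) (w z : InputSpace m T) :
    fderiv ℝ (fderiv ℝ (inputCost hT κ hl φ hf x₀ ρ)) v w z
      = fderiv ℝ (gradient hT κ hl φ hf x₀ ρ) v w (incl₁ z) := by
  refine fderiv_fderiv_of_fderiv_eventuallyEq (A := InputSpace m T) (V := InputSpace₁ m T) ?_
    (hasFDerivAt_partial_snd (contDiffAt_gradient hT κ hl φ hf x₀ hφ ρ hv)).differentiableAt w z
  filter_upwards [(solution_of_mem_solvable hT κ hf x₀ hv).1] with u hu
  exact (hasFDerivAt_inputCost hT κ hl φ hf x₀ hφ ρ hu).fderiv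

/-- The multiplier for which the partial derivative of the Lagrangian in the state vanishes. -/
def multiplier (ρ : Vec p) (q : InputSpace m T × StateSpace n T) : StateSpace n T →L[ℝ] ℝ :=
  (costDeriv hT κ hl φ ρ q ∘L ContinuousLinearMap.inr ℝ _ _) ∘L
    (dynDeriv hT κ hf q ∘L ContinuousLinearMap.inr ℝ _ _).inverse

theorem fderiv_lagrangian_comp_inr (hφ : ContDiff ℝ 2 φ) (ρ : Vec p)
    (q : InputSpace m T × StateSpace n T) :
    fderiv ℝ (lagrangian hT κ hl φ hf x₀ ρ (multiplier hT κ hl φ hf ρ q)) q ∘L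
      ContinuousLinearMap.inr ℝ (InputSpace m T) (StateSpace n T) = 0 := by
  set Λ := multiplier hT κ hl φ hf ρ q with hΛ
  have h1 : HasFDerivAt (lagrangian hT κ hl φ hf x₀ ρ Λ) _ q :=
    (hasFDerivAt_costMap hT κ hl φ hφ ρ q).sub
      (Λ.hasFDerivAt.comp q (hasFDerivAt_dynMap hT κ hf x₀ q))
  obtain ⟨e, he⟩ := isInvertible_dynDeriv_comp_inr hT κ hf q
  ext1 y
  rw [h1.fderiv]
  show costDeriv hT κ hl φ ρ q (incl₁ 0, y) - Λ (dynDeriv hT κ hf q (incl₁ 0, y)) = 0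
  have h2 : dynDeriv hT κ hf q (0, y) = e y := by
    rw [← ContinuousLinearEquiv.coe_coe, he]; rfl
  rw [map_zero, h2, hΛ, multiplier, ← he, ContinuousLinearMap.inverse_equiv]
  show costDeriv hT κ hl φ ρ q (0, y) - costDeriv hT κ hl φ ρ q (0, e.symm (e y)) = 0
  rw [e.symm_apply_apply, sub_self]

theorem inputCost_eq_lagrangian (ρ : Vec p) (Λ : StateSpace n T →L[ℝ] ℝ) {v : InputSpace m T}
    (hv : v ∈ solvable hT κ hf x₀) : inputCost hT κ hl φ hf x₀ ρ v
      = lagrangian hT κ hl φ hf x₀ ρ Λ (v, solution hT κ hf x₀ v) := by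
  rw [lagrangian, dynMap_solution hT κ hf x₀ hv, map_zero, sub_zero, inputCost]

/-- The Hessian of the cost is bounded in the `L^1` norm on pairs of functions with disjoint
supports. For the multiplier that annihilates the partial derivative of the Lagrangian in the
state, the Hessian of the cost is the Hessian of the Lagrangian along the first-order responses. -/
theorem exists_abs_hessian_le (hφ : ContDiff ℝ 2 φ) (ρ : Vec p) {v : InputSpace m T}
    (hv : v ∈ solvable hT κ hf x₀) :
    ∃ M : ℝ, ∀ w z : InputSpace m T, (∀ᵐ t ∂(timeMeasure T), w t = 0 ∨ z t = 0) →
      |fderiv ℝ (fderiv ℝ (inputCost hT κ hl φ hf x₀ ρ)) v w z|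
        ≤ M * (∫ t, ‖w t‖ ∂(timeMeasure T)) * ∫ t, ‖z t‖ ∂(timeMeasure T) := by
  set q := (v, solution hT κ hf x₀ v) with hq
  set Λ := multiplier hT κ hl φ hf ρ q with hΛ
  obtain ⟨hnhds, hcd, hder⟩ := solution_of_mem_solvable hT κ hf x₀ hv
  obtain ⟨C, hC, hbd⟩ := hasIntegralHessianBound_lagrangian hT κ hl φ hf x₀ hφ ρ Λ q
  set S := ‖solutionDeriv hT κ hf x₀ v‖ with hS
  refine ⟨C * (2 * S + T * S ^ 2), fun w z hwz => ?_⟩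
  have hev : inputCost hT κ hl φ hf x₀ ρ =ᶠ[𝓝 v]
      fun a => lagrangian hT κ hl φ hf x₀ ρ Λ (a, solution hT κ hf x₀ a) := by
    filter_upwards [hnhds] with u hu
    exact inputCost_eq_lagrangian hT κ hl φ hf x₀ ρ Λ hu
  rw [hev.fderiv.fderiv_eq, fderiv_fderiv_comp_graph
    (contDiff_lagrangian hT κ hl φ hf x₀ hφ ρ Λ) hcd hder
    (fderiv_lagrangian_comp_inr hT κ hl φ hf x₀ hφ ρ q)]
  set y := solutionDeriv hT κ hf x₀ v (incl₁ w) with hy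
  set y' := solutionDeriv hT κ hf x₀ v (incl₁ z) with hy'
  set a := ∫ t, ‖w t‖ ∂(timeMeasure T) with ha
  set b := ∫ t, ‖z t‖ ∂(timeMeasure T) with hb
  have hya : ‖y‖ ≤ S * a := by
    rw [ha, ← norm_incl₁]; exact ContinuousLinearMap.le_opNorm _ _
  have hyb : ‖y'‖ ≤ S * b := by
    rw [hb, ← norm_incl₁]; exact ContinuousLinearMap.le_opNorm _ _
  have hi1 : Integrable (fun t => S * b * ‖w t‖) (timeMeasure T) := (integrable_norm w).const_mul _
  have hi2 : Integrable (fun t => S * a * ‖z t‖) (timeMeasure T) := (integrable_norm z).const_mul _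
  have hi3 : Integrable (fun _ : ℝ => S * a * (S * b)) (timeMeasure T) := integrable_const _
  have hint : ∫ t, (S * b * ‖w t‖ + S * a * ‖z t‖ + S * a * (S * b)) ∂(timeMeasure T)
      = (2 * S + T * S ^ 2) * a * b := by
    have hi12 : Integrable (fun t => S * b * ‖w t‖ + S * a * ‖z t‖) (timeMeasure T) := hi1.add hi2
    rw [integral_add hi12 hi3, integral_add hi1 hi2, integral_const_mul,
      integral_const_mul, ← ha, ← hb]
    simp [hT.le]
    ring
  have key := hbd (w, y) (z, y') (fun t => S * b * ‖w t‖ + S * a * ‖z t‖ + S * a * (S * b))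
    ((hi1.add hi2).add hi3) (by
      filter_upwards [hwz] with t ht
      have h1 : ‖w t‖ * ‖z t‖ = 0 := by rcases ht with h | h <;> simp [h]
      have h2 : ‖w t‖ * ‖y'‖ ≤ ‖w t‖ * (S * b) := by gcongr
      have h3 : ‖y‖ * ‖z t‖ ≤ S * a * ‖z t‖ := by gcongr
      have h4 : ‖y‖ * ‖y'‖ ≤ S * a * (S * b) := by
        have : 0 ≤ S * a := (norm_nonneg _).trans hya
        gcongr
      show (‖w t‖ + ‖y‖) * (‖z t‖ + ‖y'‖) ≤ _
      nlinarith)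
  refine key.trans (le_of_eq ?_)
  rw [hint]
  ring

end Hessian

/-! ### Local minima and comparison of norms -/

section LocalMinimum

variable {A V : Type*} [NormedAddCommGroup A] [NormedSpace ℝ A]
  [NormedAddCommGroup V] [NormedSpace ℝ V]

/-- A critical point near which the second derivative is positive semidefinite is a local
minimizer. -/
theorem isLocalMin_of_fderiv_fderiv_nonneg {F : A → ℝ} {a : A} (h0 : fderiv ℝ F a = 0)
    (h : ∀ᶠ b in 𝓝 a, ContDiffAt ℝ 2 F b ∧ ∀ w, 0 ≤ fderiv ℝ (fderiv ℝ F) b w w) :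
    IsLocalMin F a := by
  obtain ⟨r, hr, hball⟩ := Metric.eventually_nhds_iff_ball.1 h
  filter_upwards [Metric.ball_mem_nhds a hr] with b hb
  set w := b - a with hw
  have hmem : ∀ s ∈ Icc (0 : ℝ) 1, a + s • w ∈ Metric.ball a r := fun s hs => by
    have hb' : ‖w‖ < r := by rwa [Metric.mem_ball, dist_eq_norm] at hb
    rw [Metric.mem_ball, dist_eq_norm, add_sub_cancel_left, norm_smul, Real.norm_eq_abs,
      abs_of_nonneg hs.1]
    exact lt_of_le_of_lt (mul_le_of_le_one_left (norm_nonneg w) hs.2) hb'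
  have hline : ∀ s : ℝ, HasDerivAt (fun s : ℝ => a + s • w) w s := fun s => by
    simpa using ((hasDerivAt_id s).smul_const w).const_add a
  have hd1 : ∀ s ∈ Icc (0 : ℝ) 1,
      HasDerivAt (fun s : ℝ => F (a + s • w)) (fderiv ℝ F (a + s • w) w) s := fun s hs =>
    (((hball _ (hmem s hs)).1.differentiableAt (by norm_num)).hasFDerivAt).comp_hasDerivAt s
      (hline s)
  have hd2 : ∀ s ∈ Icc (0 : ℝ) 1, HasDerivAt (fun s : ℝ => fderiv ℝ F (a + s • w) w)
      (fderiv ℝ (fderiv ℝ F) (a + s • w) w w) s := fun s hs => by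
    have h1 := (((hball _ (hmem s hs)).1.fderiv_right (m := 1) (by norm_num)).differentiableAt
      (by norm_num)).hasFDerivAt.comp_hasDerivAt s (hline s)
    simpa using h1.clm_apply (hasDerivAt_const s w)
  obtain ⟨θ, hθ, h1⟩ := exists_hasDerivAt_eq_slope (fun s : ℝ => F (a + s • w))
    (fun s => fderiv ℝ F (a + s • w) w) one_pos
    (fun s hs => (hd1 s hs).continuousAt.continuousWithinAt)
    (fun s hs => hd1 s ⟨hs.1.le, hs.2.le⟩)
  obtain ⟨τ, hτ, h2⟩ := exists_hasDerivAt_eq_slope (fun s : ℝ => fderiv ℝ F (a + s • w) w)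
    (fun s => fderiv ℝ (fderiv ℝ F) (a + s • w) w w) hθ.1
    (fun s hs => (hd2 s ⟨hs.1, hs.2.trans hθ.2.le⟩).continuousAt.continuousWithinAt)
    (fun s hs => hd2 s ⟨hs.1.le, (hs.2.trans hθ.2).le⟩)
  have h3 := (hball _ (hmem τ ⟨hτ.1.le, (hτ.2.trans hθ.2).le⟩)).2 w
  simp only [zero_smul, add_zero, h0, zero_apply, sub_zero, one_smul, div_one] at h1 h2
  rw [h2, le_div_iff₀ hθ.1, zero_mul, h1, hw, add_sub_cancel] at h3
  linarith

theorem fderiv_fderiv_comp_clm {G : V → ℝ} (L : A →L[ℝ] V) {a : A} (hG : ContDiffAt ℝ 2 G (L a))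
    (w z : A) : fderiv ℝ (fderiv ℝ fun a => G (L a)) a w z
      = fderiv ℝ (fderiv ℝ G) (L a) (L w) (L z) := by
  have hev : ∀ᶠ b in 𝓝 a, fderiv ℝ (fun a => G (L a)) b = fderiv ℝ G (L b) ∘L L := by
    filter_upwards [L.continuous.continuousAt.eventually (hG.eventually (by simp))] with b hb
    exact ((hb.differentiableAt (by norm_num)).hasFDerivAt.comp b L.hasFDerivAt).fderiv
  have h1 : HasFDerivAt (fun b => fderiv ℝ G (L b)) (fderiv ℝ (fderiv ℝ G) (L a) ∘L L) a :=
    ((hG.fderiv_right (m := 1) (by norm_num)).differentiableAt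
      (by norm_num)).hasFDerivAt.comp a L.hasFDerivAt
  rw [fderiv_fderiv_of_fderiv_eventuallyEq hev h1.differentiableAt, h1.fderiv]
  rfl

end LocalMinimum

section Norms

theorem integral_norm_sq_le_of_ae_le {Ω E F : Type*} [MeasurableSpace Ω] {μ : Measure Ω}
    [IsFiniteMeasure μ] [NormedAddCommGroup E] [NormedSpace ℝ E] [NormedAddCommGroup F]
    [NormedSpace ℝ F] {a : Lp E ⊤ μ} {b : Lp F ⊤ μ}
    {c : ℝ} (h : ∀ᵐ t ∂μ, ‖a t‖ ≤ c * ‖b t‖) :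
    ∫ t, ‖a t‖ ^ 2 ∂μ ≤ c ^ 2 * ∫ t, ‖b t‖ ^ 2 ∂μ := by
  rw [← integral_const_mul]
  refine integral_mono_ae (integrable_norm_sq a) ((integrable_norm_sq b).const_mul _) ?_
  filter_upwards [h] with t ht
  rw [← mul_pow]
  exact pow_le_pow_left₀ (norm_nonneg _) ht 2

theorem integral_norm_sq_add_le {Ω E : Type*} [MeasurableSpace Ω] {μ : Measure Ω}
    [IsFiniteMeasure μ] [NormedAddCommGroup E] [NormedSpace ℝ E] (a b : Lp E ⊤ μ) :
    ∫ t, ‖(a + b) t‖ ^ 2 ∂μ ≤ 2 * (∫ t, ‖a t‖ ^ 2 ∂μ) + 2 * ∫ t, ‖b t‖ ^ 2 ∂μ := by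
  rw [← integral_const_mul, ← integral_const_mul,
    ← integral_add ((integrable_norm_sq a).const_mul _) ((integrable_norm_sq b).const_mul _)]
  refine integral_mono_ae (integrable_norm_sq _)
    (((integrable_norm_sq a).const_mul _).add ((integrable_norm_sq b).const_mul _)) ?_
  filter_upwards [Lp.coeFn_add a b] with t ht
  show ‖(a + b) t‖ ^ 2 ≤ 2 * ‖a t‖ ^ 2 + 2 * ‖b t‖ ^ 2
  rw [ht, Pi.add_apply]
  have := norm_add_le (a t) (b t)
  nlinarith [norm_nonneg (a t + b t), sq_nonneg (‖a t‖ - ‖b t‖)]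

variable {n m : ℕ} {T : ℝ} (hT : 0 < T) (κ : GainSpace n m T)

theorem sqL2_eq (ζ : Curve n m T) : Curve.sqL2 hT ζ
    = (∫ t, ‖stateOp hT ζ.1 t‖ ^ 2 ∂(timeMeasure T)) + ∫ t, ‖ζ.2 t‖ ^ 2 ∂(timeMeasure T) := by
  rw [Curve.sqL2, intervalIntegral.integral_of_le hT.le, ← integral_Icc_eq_integral_Ioc,
    ← integral_add (integrable_norm_sq _) (integrable_norm_sq _)]
  refine integral_congr_ae ?_
  filter_upwards [coeFn_stateOp hT ζ.1] with t ht
  show _ = ‖stateOp hT ζ.1 t‖ ^ 2 + ‖ζ.2 t‖ ^ 2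
  rw [ht]
  rfl

theorem integral_norm_sq_feedbackOp_le (x : StateSpace n T) :
    ∫ t, ‖feedbackOp hT κ x t‖ ^ 2 ∂(timeMeasure T)
      ≤ ‖κ‖ ^ 2 * ∫ t, ‖stateOp hT x t‖ ^ 2 ∂(timeMeasure T) := by
  refine integral_norm_sq_le_of_ae_le ?_
  filter_upwards [coeFn_mulOp κ (stateOp hT x), ae_norm_le_norm κ] with t h1 h2
  have h3 : feedbackOp hT κ x t = κ t (stateOp hT x t) := h1
  rw [h3]
  exact (κ t).le_of_opNorm_le h2 _

theorem integral_norm_sq_feedforward_le (ζ : Curve n m T) :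
    ∫ t, ‖feedforward hT κ ζ t‖ ^ 2 ∂(timeMeasure T) ≤ 2 * (1 + ‖κ‖ ^ 2) * Curve.sqL2 hT ζ := by
  rw [sqL2_eq, feedforward_apply]
  have h1 := integral_norm_sq_add_le ζ.2 (feedbackOp hT κ ζ.1)
  have h2 := integral_norm_sq_feedbackOp_le hT κ ζ.1
  have h3 := integral_norm_sq_nonneg ζ.2
  have h4 := integral_norm_sq_nonneg (stateOp hT ζ.1)
  nlinarith [sq_nonneg ‖κ‖, mul_nonneg (sq_nonneg ‖κ‖) h3]

theorem integral_norm_sq_stateOp_le (x : StateSpace n T) :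
    ∫ t, ‖stateOp hT x t‖ ^ 2 ∂(timeMeasure T) ≤ T * ‖x‖ ^ 2 := by
  have h : ∫ _, ‖x‖ ^ 2 ∂(timeMeasure T) = T * ‖x‖ ^ 2 := by simp [hT.le]
  rw [← h]
  refine integral_mono_ae (integrable_norm_sq _) (integrable_const _) ?_
  filter_upwards [coeFn_stateOp hT x] with t ht
  show ‖stateOp hT x t‖ ^ 2 ≤ ‖x‖ ^ 2
  rw [ht]
  exact pow_le_pow_left₀ (norm_nonneg _) (x.norm_coe_le_norm _) 2

/-- The `L_2` norm of a first-order response is bounded by that of its feedforward. -/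
theorem sqL2_curveOp_le (Y : InputSpace₁ m T →L[ℝ] StateSpace n T) (w : InputSpace m T) :
    Curve.sqL2 hT (curveOp hT κ (w, Y (incl₁ w)))
      ≤ (2 + (1 + 2 * ‖κ‖ ^ 2) * (T ^ 2 * ‖Y‖ ^ 2)) * ∫ t, ‖w t‖ ^ 2 ∂(timeMeasure T) := by
  set y := Y (incl₁ w) with hy
  rw [sqL2_eq, curveOp_apply]
  have h0 : ‖y‖ ≤ ‖Y‖ * ∫ t, ‖w t‖ ∂(timeMeasure T) := by
    rw [← norm_incl₁]; exact Y.le_opNorm _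
  have hV : (timeMeasure T).real univ = T := by simp [hT.le]
  have h1 : ‖y‖ ^ 2 ≤ ‖Y‖ ^ 2 * (T * ∫ t, ‖w t‖ ^ 2 ∂(timeMeasure T)) := by
    have h2 := sq_integral_norm_le w
    rw [hV] at h2
    calc ‖y‖ ^ 2 ≤ (‖Y‖ * ∫ t, ‖w t‖ ∂(timeMeasure T)) ^ 2 :=
          pow_le_pow_left₀ (norm_nonneg _) h0 2
      _ = ‖Y‖ ^ 2 * (∫ t, ‖w t‖ ∂(timeMeasure T)) ^ 2 := mul_pow _ _ _
      _ ≤ _ := by gcongr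
  have h3 := integral_norm_sq_stateOp_le hT y
  have h4 := integral_norm_sq_feedbackOp_le hT κ y
  have h5 := integral_norm_sq_add_le w (-feedbackOp hT κ y)
  have h6 : ∫ t, ‖(-feedbackOp hT κ y) t‖ ^ 2 ∂(timeMeasure T)
      = ∫ t, ‖feedbackOp hT κ y t‖ ^ 2 ∂(timeMeasure T) := by
    refine integral_congr_ae ?_
    filter_upwards [Lp.coeFn_neg (feedbackOp hT κ y)] with t ht
    rw [ht, Pi.neg_apply, norm_neg]
  rw [h6, ← sub_eq_add_neg] at h5
  set s := ∫ t, ‖w t‖ ^ 2 ∂(timeMeasure T)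
  set σ := ∫ t, ‖stateOp hT y t‖ ^ 2 ∂(timeMeasure T)
  have h7 : σ ≤ T ^ 2 * ‖Y‖ ^ 2 * s := by
    calc σ ≤ T * ‖y‖ ^ 2 := h3
      _ ≤ T * (‖Y‖ ^ 2 * (T * s)) := by gcongr
      _ = _ := by ring
  have h8 : (1 + 2 * ‖κ‖ ^ 2) * σ ≤ (1 + 2 * ‖κ‖ ^ 2) * (T ^ 2 * ‖Y‖ ^ 2 * s) := by gcongr
  show σ + ∫ t, ‖(w - feedbackOp hT κ y) t‖ ^ 2 ∂(timeMeasure T) ≤ _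
  nlinarith

end Norms

/-! ### Critical points and SSC local minimizers -/

section Perturbation

variable {n m p : ℕ} {T : ℝ} (hT : 0 < T) (κ : GainSpace n m T)
  {l : ℝ → Vec n × Vec m × Vec p → ℝ} (hl : ContDiffTwoFamily l) (φ : Vec n × Vec p → ℝ)
  {f : Vec n × Vec m → Vec n} (hf : ContDiffTwoFamily fun _ : ℝ => f) (x₀ : Vec n)

/-- The Hessian of the cost in the feedforward, as a map from `L^∞` to `(L^1)*`. -/
def hessian (r : Vec p × InputSpace m T) : InputSpace m T →L[ℝ] (InputSpace₁ m T →L[ℝ] ℝ) :=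
  fderiv ℝ (fun r : Vec p × InputSpace m T => gradient hT κ hl φ hf x₀ r.1 r.2) r ∘L
    ContinuousLinearMap.inr ℝ (Vec p) (InputSpace m T)

theorem hessian_apply (hφ : ContDiff ℝ 2 φ) (ρ : Vec p) {v : InputSpace m T}
    (hv : v ∈ solvable hT κ hf x₀) (w z : InputSpace m T) :
    hessian hT κ hl φ hf x₀ (ρ, v) w (incl₁ z)
      = fderiv ℝ (fderiv ℝ (inputCost hT κ hl φ hf x₀ ρ)) v w z := by
  rw [fderiv_fderiv_inputCost hT κ hl φ hf x₀ hφ ρ hv,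
    (hasFDerivAt_partial_snd (contDiffAt_gradient hT κ hl φ hf x₀ hφ ρ hv)).fderiv]
  rfl

theorem hessian_symm (hφ : ContDiff ℝ 2 φ) (ρ : Vec p) {v : InputSpace m T}
    (hv : v ∈ solvable hT κ hf x₀) (w z : InputSpace m T) :
    hessian hT κ hl φ hf x₀ (ρ, v) w (incl₁ z) = hessian hT κ hl φ hf x₀ (ρ, v) z (incl₁ w) := by
  rw [hessian_apply hT κ hl φ hf x₀ hφ ρ hv, hessian_apply hT κ hl φ hf x₀ hφ ρ hv]
  exact (contDiffAt_inputCost hT κ hl φ hf x₀ hφ ρ hv).isSymmSndFDerivAt (by simp) w z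

theorem continuousAt_hessian (hφ : ContDiff ℝ 2 φ) (ρ : Vec p) {v : InputSpace m T}
    (hv : v ∈ solvable hT κ hf x₀) :
    ContinuousAt (hessian hT κ hl φ hf x₀) (ρ, v) := by
  have h := (contDiffAt_gradient hT κ hl φ hf x₀ hφ ρ hv).continuousAt_fderiv (by norm_num)
  exact ContinuousAt.clm_comp h continuousAt_const

/-- Coercivity of the Hessian in the `L^2` norm is stable under small perturbations of parameter and
feedforward in the `L^∞` norm, because the Hessian is continuous as a map from `L^∞` to `(L^1)*` and
symmetric. -/
theorem eventually_hessian_coercive (hφ : ContDiff ℝ 2 φ) (ρ : Vec p) {v : InputSpace m T}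
    (hv : v ∈ solvable hT κ hf x₀) {c : ℝ} (hc : 0 < c)
    (hcoer : ∀ w, c * ∫ t, ‖w t‖ ^ 2 ∂(timeMeasure T)
      ≤ hessian hT κ hl φ hf x₀ (ρ, v) w (incl₁ w)) :
    ∀ᶠ r : Vec p × InputSpace m T in 𝓝 (ρ, v), r.2 ∈ solvable hT κ hf x₀ ∧
      ∀ w, c / 2 * ∫ t, ‖w t‖ ^ 2 ∂(timeMeasure T)
        ≤ hessian hT κ hl φ hf x₀ r w (incl₁ w) := by
  obtain ⟨C, hC, hsymm⟩ := exists_abs_le_integral_norm_sq (μ := timeMeasure T) (H := Vec m)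
  have h1 : ∀ᶠ r : Vec p × InputSpace m T in 𝓝 (ρ, v), r.2 ∈ solvable hT κ hf x₀ :=
    continuousAt_snd.eventually (solution_of_mem_solvable hT κ hf x₀ hv).1
  have h2 : ∀ᶠ r : Vec p × InputSpace m T in 𝓝 (ρ, v),
      ‖hessian hT κ hl φ hf x₀ r - hessian hT κ hl φ hf x₀ (ρ, v)‖ < c / (2 * C) := by
    have h := Metric.tendsto_nhds.1 (continuousAt_hessian hT κ hl φ hf x₀ hφ ρ hv)
      (c / (2 * C)) (by positivity)
    filter_upwards [h] with r hr
    rwa [dist_eq_norm] at hr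
  filter_upwards [h1, h2] with r hr1 hr2
  refine ⟨hr1, fun w => ?_⟩
  set B := hessian hT κ hl φ hf x₀ r - hessian hT κ hl φ hf x₀ (ρ, v) with hB
  have happ : ∀ w z, B w (incl₁ z) = hessian hT κ hl φ hf x₀ r w (incl₁ z)
      - hessian hT κ hl φ hf x₀ (ρ, v) w (incl₁ z) := fun _ _ => rfl
  have h3 := hsymm B (fun w z => by
    rw [happ, happ, hessian_symm hT κ hl φ hf x₀ hφ r.1 hr1,
      hessian_symm hT κ hl φ hf x₀ hφ ρ hv]) w
  rw [happ] at h3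
  have h4 := (abs_le.1 h3).1
  have h5 := integral_norm_sq_nonneg w
  have h6 : C * ‖B‖ * ∫ t, ‖w t‖ ^ 2 ∂(timeMeasure T)
      ≤ c / 2 * ∫ t, ‖w t‖ ^ 2 ∂(timeMeasure T) := by
    refine mul_le_mul_of_nonneg_right ?_ h5
    calc C * ‖B‖ ≤ C * (c / (2 * C)) := by gcongr
      _ = c / 2 := by field_simp
  have h7 := hcoer w
  linarith

/-- Persistence of nondegenerate critical points: the implicit function theorem for the equation
`gradient = 0` in `(L^1)*`. -/
theorem exists_criticalPoint (hφ : ContDiff ℝ 2 φ) (ρ : Vec p) {v : InputSpace m T}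
    (hv : v ∈ solvable hT κ hf x₀) (hgrad : gradient hT κ hl φ hf x₀ ρ v = 0) {c : ℝ} (hc : 0 < c)
    (hcoer : ∀ w, c * ∫ t, ‖w t‖ ^ 2 ∂(timeMeasure T)
      ≤ hessian hT κ hl φ hf x₀ (ρ, v) w (incl₁ w)) :
    ∃ ψ : Vec p → InputSpace m T, ψ ρ = v ∧ ContDiffAt ℝ 1 ψ ρ ∧
      ∀ᶠ σ in 𝓝 ρ, gradient hT κ hl φ hf x₀ σ (ψ σ) = 0 := by
  obtain ⟨M, hM⟩ := exists_abs_hessian_le hT κ hl φ hf x₀ hφ ρ hv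
  have hinv : (hessian hT κ hl φ hf x₀ (ρ, v)).IsInvertible :=
    isInvertible_of_coercive hc _ hcoer fun w z hwz => by
      rw [hessian_apply hT κ hl φ hf x₀ hφ ρ hv]
      exact hM w z hwz
  have hcd := contDiffAt_gradient hT κ hl φ hf x₀ hφ ρ hv
  refine ⟨hcd.implicitFunction one_ne_zero hinv, hcd.implicitFunction_apply_self one_ne_zero hinv,
    hcd.contDiffAt_implicitFunction one_ne_zero hinv, ?_⟩
  filter_upwards [hcd.eventually_apply_implicitFunction one_ne_zero hinv] with σ hσ
  exact hσ.trans hgrad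

variable {K : ℝ → Vec n →L[ℝ] Vec m} {l' : ℝ → Vec n × Vec m × Vec p → ℝ}

theorem reducedCost_eventuallyEq (hκ : κ =ᵐ[timeMeasure T] K)
    (hl' : ∀ t ∈ Icc (0 : ℝ) T, l' t = l t) (ρ : Vec p) {ξ : Curve n m T}
    (hξ : feedforward hT κ ξ ∈ solvable hT κ hf x₀) :
    reducedCost hT f x₀ K l' φ ρ =ᶠ[𝓝 ξ]
      fun ζ => inputCost hT κ hl φ hf x₀ ρ (feedforward hT κ ζ) := by
  filter_upwards [eventually_feedforward_mem_solvable hT κ hf x₀ hξ] with ζ hζ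
  exact reducedCost_eq_inputCost hT κ hl φ hf x₀ hκ hl' ρ hζ

theorem contDiffAt_reducedCost (hl : ContDiffTwoFamily l) (hφ : ContDiff ℝ 2 φ)
    (hκ : κ =ᵐ[timeMeasure T] K)
    (hl' : ∀ t ∈ Icc (0 : ℝ) T, l' t = l t) (ρ : Vec p) {ξ : Curve n m T}
    (hξ : feedforward hT κ ξ ∈ solvable hT κ hf x₀) :
    ContDiffAt ℝ 2 (reducedCost hT f x₀ K l' φ ρ) ξ :=
  ((contDiffAt_inputCost hT κ hl φ hf x₀ hφ ρ hξ).comp ξ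
    (feedforward hT κ).contDiff.contDiffAt).congr_of_eventuallyEq
      (reducedCost_eventuallyEq hT κ hl φ hf x₀ hκ hl' ρ hξ)

theorem fderiv_fderiv_reducedCost (hφ : ContDiff ℝ 2 φ) (hκ : κ =ᵐ[timeMeasure T] K)
    (hl' : ∀ t ∈ Icc (0 : ℝ) T, l' t = l t) (ρ : Vec p) {ξ : Curve n m T}
    (hξ : feedforward hT κ ξ ∈ solvable hT κ hf x₀) (ζ : Curve n m T) :
    fderiv ℝ (fderiv ℝ (reducedCost hT f x₀ K l' φ ρ)) ξ ζ ζ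
      = hessian hT κ hl φ hf x₀ (ρ, feedforward hT κ ξ) (feedforward hT κ ζ)
          (incl₁ (feedforward hT κ ζ)) := by
  rw [(reducedCost_eventuallyEq hT κ hl φ hf x₀ hκ hl' ρ hξ).fderiv.fderiv_eq,
    fderiv_fderiv_comp_clm (feedforward hT κ) (contDiffAt_inputCost hT κ hl φ hf x₀ hφ ρ hξ),
    hessian_apply hT κ hl φ hf x₀ hφ ρ hξ]

/-- An SSC local minimizer is a critical point, with coercive Hessian, of the cost as a function of
the feedforward. -/
theorem IsSSCLocalMinimizer.gradient_eq_zero_and_coercive (hφ : ContDiff ℝ 2 φ)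
    (hκ : κ =ᵐ[timeMeasure T] K) (hl' : ∀ t ∈ Icc (0 : ℝ) T, l' t = l t) {ρ : Vec p}
    {ξ : Curve n m T}
    (h : IsSSCLocalMinimizer hT f x₀ K (reducedCost hT f x₀ K l' φ ρ) ξ) :
    gradient hT κ hl φ hf x₀ ρ (feedforward hT κ ξ) = 0 ∧ ∃ c : ℝ, 0 < c ∧
      ∀ w, c * ∫ t, ‖w t‖ ^ 2 ∂(timeMeasure T)
        ≤ hessian hT κ hl φ hf x₀ (ρ, feedforward hT κ ξ) w (incl₁ w) := by
  obtain ⟨htraj, hmin, c, hc, hcoer⟩ := h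
  have hξ := feedforward_mem_solvable hT κ hf x₀ htraj
  constructor
  · have h1 : HasFDerivAt (reducedCost hT f x₀ K l' φ ρ) _ ξ :=
      ((hasFDerivAt_inputCost hT κ hl φ hf x₀ hφ ρ hξ).comp ξ
        (feedforward hT κ).hasFDerivAt).congr_of_eventuallyEq
          (reducedCost_eventuallyEq hT κ hl φ hf x₀ hκ hl' ρ hξ)
    have h2 := hmin.hasFDerivAt_eq_zero h1
    refine ext_incl₁ fun w => ?_
    -- the curve `(0, w)` has feedforward `w`
    have h3 := congrArg (fun g : Curve n m T →L[ℝ] ℝ => g (curveOp hT κ (w, 0))) h2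
    have h4 : gradient hT κ hl φ hf x₀ ρ (feedforward hT κ ξ)
        (incl₁ (feedforward hT κ (curveOp hT κ (w, 0)))) = 0 := h3
    rw [feedforward_curveOp] at h4
    exact h4
  · refine ⟨c / (2 * (1 + ‖κ‖ ^ 2)), by positivity, fun w => ?_⟩
    -- the tangent vector with feedforward `w`
    set ζ := curveOp hT κ (w, solutionDeriv hT κ hf x₀ (feedforward hT κ ξ) (incl₁ w)) with hζ
    have hw : feedforward hT κ ζ = w := feedforward_curveOp hT κ _
    have h1 : ζ ∈ tangentSpace hT f x₀ K ξ := by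
      rw [mem_tangentSpace_iff hT κ hf x₀ hκ hξ, hw]
    have h2 := hcoer ζ h1
    rw [fderiv_fderiv_reducedCost hT κ hl φ hf x₀ hφ hκ hl' ρ hξ, hw] at h2
    have h3 := integral_norm_sq_feedforward_le hT κ ζ
    rw [hw] at h3
    refine le_trans ?_ h2
    rw [div_mul_eq_mul_div, div_le_iff₀ (by positivity)]
    nlinarith

/-- A critical point of the cost as a function of the feedforward, near which the Hessian is
coercive, gives an SSC local minimizer. -/
theorem isSSCLocalMinimizer_response (hφ : ContDiff ℝ 2 φ)
    (hκ : κ =ᵐ[timeMeasure T] K) (hl' : ∀ t ∈ Icc (0 : ℝ) T, l' t = l t) {ρ : Vec p}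
    {v : InputSpace m T} (hgrad : gradient hT κ hl φ hf x₀ ρ v = 0) {c : ℝ} (hc : 0 < c)
    (hcoer : ∀ᶠ u in 𝓝 v, u ∈ solvable hT κ hf x₀ ∧ ∀ w, c * ∫ t, ‖w t‖ ^ 2 ∂(timeMeasure T)
        ≤ hessian hT κ hl φ hf x₀ (ρ, u) w (incl₁ w)) :
    IsSSCLocalMinimizer hT f x₀ K (reducedCost hT f x₀ K l' φ ρ) (response hT κ hf x₀ v) := by
  obtain ⟨hv, hcoerv⟩ := hcoer.self_of_nhds
  have hff : feedforward hT κ (response hT κ hf x₀ v) = v := feedforward_response hT κ hf x₀ v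
  have hξ : feedforward hT κ (response hT κ hf x₀ v) ∈ solvable hT κ hf x₀ := by rwa [hff]
  have hmin : IsLocalMin (inputCost hT κ hl φ hf x₀ ρ) v := by
    refine isLocalMin_of_fderiv_fderiv_nonneg ?_ ?_
    · rw [(hasFDerivAt_inputCost hT κ hl φ hf x₀ hφ ρ hv).fderiv, hgrad,
        ContinuousLinearMap.zero_comp]
    · filter_upwards [hcoer] with u hu
      refine ⟨contDiffAt_inputCost hT κ hl φ hf x₀ hφ ρ hu.1, fun w => ?_⟩
      rw [← hessian_apply hT κ hl φ hf x₀ hφ ρ hu.1]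
      exact le_trans (mul_nonneg hc.le (integral_norm_sq_nonneg w)) (hu.2 w)
  refine ⟨response_mem_trajectories hT κ hf x₀ hv, ?_, ?_⟩
  · have heq := reducedCost_eventuallyEq hT κ hl φ hf x₀ hκ hl' ρ hξ
    have hm : ∀ᶠ u in 𝓝 (feedforward hT κ (response hT κ hf x₀ v)),
        inputCost hT κ hl φ hf x₀ ρ v ≤ inputCost hT κ hl φ hf x₀ ρ u := by
      rw [hff]
      exact hmin
    have h1 := (feedforward hT κ).continuous.continuousAt.eventually hm
    filter_upwards [h1, heq] with ζ h2 h3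
    have h4 := heq.self_of_nhds
    simp only [hff] at h4
    rw [h3, h4]
    exact h2
  · set S := 2 + (1 + 2 * ‖κ‖ ^ 2) * (T ^ 2 * ‖solutionDeriv hT κ hf x₀ v‖ ^ 2) with hS
    have hS0 : 0 < S := by positivity
    refine ⟨c / S, by positivity, fun ζ hζ => ?_⟩
    rw [mem_tangentSpace_iff hT κ hf x₀ hκ hξ, hff] at hζ
    rw [fderiv_fderiv_reducedCost hT κ hl φ hf x₀ hφ hκ hl' ρ hξ, hff]
    have h1 := sqL2_curveOp_le hT κ (solutionDeriv hT κ hf x₀ v) (feedforward hT κ ζ)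
    rw [hζ, ← hS] at h1
    refine le_trans ?_ (hcoerv _)
    rw [div_mul_eq_mul_div, div_le_iff₀ hS0]
    calc c * Curve.sqL2 hT ζ ≤ c * (S * ∫ t, ‖feedforward hT κ ζ t‖ ^ 2 ∂(timeMeasure T)) := by
          gcongr
      _ = _ := by ring

end Perturbation

end TrajOpt

end

theorem mainTheorem3 {n m p : ℕ} {T : ℝ} (hT : 0 < T)
    (f : TrajOpt.Vec n × TrajOpt.Vec m → TrajOpt.Vec n) (hf : ContDiff ℝ 2 f)
    (x₀ : TrajOpt.Vec n)
    (K : ℝ → TrajOpt.Vec n →L[ℝ] TrajOpt.Vec m)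
    (hK_meas : AEStronglyMeasurable K (volume.restrict (Icc (0 : ℝ) T)))
    (hK_bdd : ∃ C : ℝ, ∀ᵐ t ∂(volume.restrict (Icc (0 : ℝ) T)), ‖K t‖ ≤ C)
    (l : ℝ → TrajOpt.Vec n × TrajOpt.Vec m × TrajOpt.Vec p → ℝ)
    (hl : ∀ t ∈ Icc (0 : ℝ) T, ContDiff ℝ 2 (l t))
    (hl_cont : ∀ k : ℕ, k ≤ 2 → ContinuousOn
      (fun q : ℝ × (TrajOpt.Vec n × TrajOpt.Vec m × TrajOpt.Vec p) =>
        iteratedFDeriv ℝ k (l q.1) q.2) (Icc (0 : ℝ) T ×ˢ univ))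
    (φ : TrajOpt.Vec n × TrajOpt.Vec p → ℝ) (hφ : ContDiff ℝ 2 φ)
    (ξ₀ : TrajOpt.Curve n m T)
    (hξ₀ : TrajOpt.IsSSCLocalMinimizer hT f x₀ K
      (TrajOpt.reducedCost hT f x₀ K l φ 0) ξ₀) :
    ∃ δ : ℝ, 0 < δ ∧ ∃ ξ : TrajOpt.Vec p → TrajOpt.Curve n m T,
      ξ 0 = ξ₀ ∧
      ContDiffOn ℝ 1 ξ (Metric.ball 0 δ) ∧
      ∀ ρ ∈ Metric.ball (0 : TrajOpt.Vec p) δ,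
        TrajOpt.projectionDom hT f x₀ K ∈ 𝓝 (ξ ρ) ∧
        ContDiffAt ℝ 2 (TrajOpt.projection hT f x₀ K) (ξ ρ) ∧
        ContDiffAt ℝ 2 (TrajOpt.reducedCost hT f x₀ K l φ ρ) (ξ ρ) ∧
        TrajOpt.IsSSCLocalMinimizer hT f x₀ K
          (TrajOpt.reducedCost hT f x₀ K l φ ρ) (ξ ρ) := by
  obtain ⟨C, hC⟩ := hK_bdd
  have hK := memLp_top_of_bound hK_meas C hC
  have hκ : hK.toLp K =ᵐ[TrajOpt.timeMeasure T] K := hK.coeFn_toLp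
  have hf' := TrajOpt.contDiffTwoFamily_const hf
  have hl' := TrajOpt.contDiffTwoFamily_projIcc hT.le hl hl_cont
  have hll : ∀ t ∈ Icc (0 : ℝ) T, l t = l (projIcc 0 T hT.le t) := fun t ht => by
    rw [projIcc_of_mem hT.le ht]
  have hv₀ := TrajOpt.feedforward_mem_solvable hT (hK.toLp K) hf' x₀ hξ₀.1
  have hξ₀' := TrajOpt.response_feedforward hT (hK.toLp K) hf' x₀ hξ₀.1
  obtain ⟨hgrad, c, hc, hcoer⟩ := TrajOpt.IsSSCLocalMinimizer.gradient_eq_zero_and_coercive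
    hT (hK.toLp K) hl' φ hf' x₀ hφ hκ hll hξ₀
  obtain ⟨ψ, hψ0, hψ, hcrit⟩ := TrajOpt.exists_criticalPoint hT (hK.toLp K) hl' φ hf' x₀ hφ 0
    hv₀ hgrad hc hcoer
  have hnear := TrajOpt.eventually_hessian_coercive hT (hK.toLp K) hl' φ hf' x₀ hφ 0 hv₀ hc hcoer
  rw [← hψ0] at hnear
  -- for small `ρ` the Hessian is coercive on a neighbourhood of `(ρ, ψ ρ)`
  have hnear' := (continuousAt_id.prodMk hψ.continuousAt).eventually hnear.eventually_nhds
  obtain ⟨δ, hδ, hball⟩ := Metric.eventually_nhds_iff_ball.1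
    (hcrit.and (hnear'.and (hψ.eventually (by simp))))
  refine ⟨δ, hδ, fun ρ => TrajOpt.response hT (hK.toLp K) hf' x₀ (ψ ρ), ?_, ?_, ?_⟩
  · exact (congrArg (TrajOpt.response hT (hK.toLp K) hf' x₀) hψ0).trans hξ₀'
  · intro ρ hρ
    obtain ⟨-, h1, h2⟩ := hball ρ hρ
    exact (((TrajOpt.contDiffAt_response hT (hK.toLp K) hf' x₀ h1.self_of_nhds.1).of_le
      (by norm_num)).comp ρ h2).contDiffWithinAt
  · intro ρ hρ
    obtain ⟨h0, h1, -⟩ := hball ρ hρ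
    have hξ : TrajOpt.feedforward hT (hK.toLp K)
        (TrajOpt.response hT (hK.toLp K) hf' x₀ (ψ ρ))
        ∈ TrajOpt.solvable hT (hK.toLp K) hf' x₀ := by
      rw [TrajOpt.feedforward_response]
      exact h1.self_of_nhds.1
    refine ⟨?_, TrajOpt.contDiffAt_projection hT (hK.toLp K) hf' x₀ hκ hξ,
      TrajOpt.contDiffAt_reducedCost hT (hK.toLp K) φ hf' x₀ hl' hφ hκ hll ρ hξ,
      TrajOpt.isSSCLocalMinimizer_response hT (hK.toLp K) hl' φ hf' x₀ hφ hκ hll h0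
        (half_pos hc) ?_⟩
    · filter_upwards [TrajOpt.eventually_feedforward_mem_solvable hT (hK.toLp K) hf' x₀ hξ]
        with ζ hζ
      exact TrajOpt.mem_projectionDom hT (hK.toLp K) hf' x₀ hκ hζ
    · have h2 : ContinuousAt (fun u : TrajOpt.InputSpace m T => (ρ, u)) (ψ ρ) := by fun_prop
      exact h2.eventually h1
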